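/- Computations take place on a real RAM: a random access machine with integer registers, real registers and real arrays, in which integer $+$ and truncated $-$, real $+,-,\cdot,/$, $\sin$, $\cos$, rational constants, comparisons and memory accesses have unit cost. A decision problem $\mathrm{pr}_1$ is $f(n)$-solvable using a decision problem $\mathrm{pr}_2$, written $\mathrm{pr}_1\le_{f(n)}\mathrm{pr}_2$, if some program decides every instance of $\mathrm{pr}_1$ of size $n$ by using a constant number of instances of $\mathrm{pr}_2$ (each written down by the program, of size $O(n)$, and then answered by an oracle) and $O(f(n))$ additional time. Consider the following problems. - $\mathrm{SegContPnt}$: given a set $P$ of $n$ real numbers and a set $Q$ of $m=O(n)$ pairwise disjoint closed bounded intervals of real numbers (possibly single points), each in arbitrary order, is there $v\in\mathbb R$ such that $P+v\subseteq\bigcup Q$? - $\mathrm{ConvPolyContRot}$: given two convex polygons $P$ and $Q$ in the plane with $n$ and $m=O(n)$ edges, respectively (as lists of their vertices in counterclockwise order), is there a rotation of $P$ around the origin that makes it contained in $Q$? - $\mathrm{ConvPolyContRigidMot}$: given $P$ and $Q$ as in the previous problem, is there a rigid motion (a rotation followed by a translation) of $P$ that makes it contained in $Q$? In each of them the size of an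 instance is $n$, and $m=O(n)$ means $m\le c\,n$ for a fixed constant $c$ that belongs to the problem. **Theorem.** $\mathrm{SegContPnt}\le_{n\log n}\mathrm{ConvPolyContRot}$ and $\mathrm{SegContPnt}\le_{n\log n}\mathrm{ConvPolyContRigidMot}$. That is, for every constant $c$ in $\mathrm{SegContPnt}$ there is a constant $c'$ for which the reduction to the polygon problem with constant $c'$ exists. -/

import Mathlib

/-! ### A real random access machine with an oracle

Structured programs over finitely many integer registers, real registers and real arrays.
Every arithmetic operation, comparison, memory access and elementary command has unit cost;
the available real functions are `+`, `-`, `*`, `/`, `sin` and `cos`, and the real constants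
of a program are rational. -/

namespace RealRAM

/-- A memory configuration: integer registers, real registers, and real arrays
(`arr a j` is cell `j` of array `a`). -/
structure State where
  int : ℕ → ℕ
  real : ℕ → ℝ
  arr : ℕ → ℕ → ℝ

/-- Integer expressions (used as counters and addresses); `sub` is truncated subtraction. -/
inductive IExp where
  | const (n : ℕ)
  | reg (i : ℕ)
  | add (e₁ e₂ : IExp)
  | sub (e₁ e₂ : IExp)

def IExp.eval (s : State) : IExp → ℕ
  | .const n => n
  | .reg i => s.int i
  | .add e₁ e₂ => e₁.eval s + e₂.eval s
  | .sub e₁ e₂ => e₁.eval s - e₂.eval s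

/-- The number of unit-cost operations needed to evaluate the expression. -/
def IExp.cost : IExp → ℕ
  | .const _ => 1
  | .reg _ => 1
  | .add e₁ e₂ => e₁.cost + e₂.cost + 1
  | .sub e₁ e₂ => e₁.cost + e₂.cost + 1

/-- Real expressions; `load a e` reads array `a` at the address `e`. -/
inductive RExp where
  | const (q : ℚ)
  | reg (i : ℕ)
  | load (a : ℕ) (e : IExp)
  | add (e₁ e₂ : RExp)
  | sub (e₁ e₂ : RExp)
  | mul (e₁ e₂ : RExp)
  | div (e₁ e₂ : RExp)
  | sin (e : RExp)
  | cos (e : RExp)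

noncomputable def RExp.eval (s : State) : RExp → ℝ
  | .const q => (q : ℝ)
  | .reg i => s.real i
  | .load a e => s.arr a (e.eval s)
  | .add e₁ e₂ => e₁.eval s + e₂.eval s
  | .sub e₁ e₂ => e₁.eval s - e₂.eval s
  | .mul e₁ e₂ => e₁.eval s * e₂.eval s
  | .div e₁ e₂ => e₁.eval s / e₂.eval s
  | .sin e => Real.sin (e.eval s)
  | .cos e => Real.cos (e.eval s)

def RExp.cost : RExp → ℕ
  | .const _ => 1
  | .reg _ => 1
  | .load _ e => e.cost + 1
  | .add e₁ e₂ => e₁.cost + e₂.cost + 1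
  | .sub e₁ e₂ => e₁.cost + e₂.cost + 1
  | .mul e₁ e₂ => e₁.cost + e₂.cost + 1
  | .div e₁ e₂ => e₁.cost + e₂.cost + 1
  | .sin e => e.cost + 1
  | .cos e => e.cost + 1

/-- Tests: comparisons of integers and of reals, and Boolean combinations. -/
inductive BExp where
  | ilt (e₁ e₂ : IExp)
  | rlt (e₁ e₂ : RExp)
  | not (b : BExp)
  | and (b₁ b₂ : BExp)

def BExp.holds (s : State) : BExp → Prop
  | .ilt e₁ e₂ => e₁.eval s < e₂.eval s
  | .rlt e₁ e₂ => e₁.eval s < e₂.eval s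
  | .not b => ¬ b.holds s
  | .and b₁ b₂ => b₁.holds s ∧ b₂.holds s

def BExp.cost : BExp → ℕ
  | .ilt e₁ e₂ => e₁.cost + e₂.cost + 1
  | .rlt e₁ e₂ => e₁.cost + e₂.cost + 1
  | .not b => b.cost + 1
  | .and b₁ b₂ => b₁.cost + b₂.cost + 1

/-- Programs. `ask as r` submits to the oracle the arrays listed in `as` (array `a` being cut off
at the length that stands in integer register `a`) and receives the answer, `1` for yes and `0`
for no, in integer register `r`. -/
inductive Prog where
  | skip
  | setI (i : ℕ) (e : IExp)
  | setR (i : ℕ) (e : RExp)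
  | store (a : ℕ) (e : IExp) (v : RExp)
  | seq (p₁ p₂ : Prog)
  | ite (b : BExp) (p₁ p₂ : Prog)
  | loop (b : BExp) (p : Prog)
  | ask (as : List ℕ) (r : ℕ)

def State.setInt (s : State) (i n : ℕ) : State :=
  { s with int := Function.update s.int i n }

def State.setReal (s : State) (i : ℕ) (x : ℝ) : State :=
  { s with real := Function.update s.real i x }

def State.setCell (s : State) (a j : ℕ) (x : ℝ) : State :=
  { s with arr := Function.update s.arr a (Function.update (s.arr a) j x) }

/-- The finite sequence held by array `a`, of the length given by integer register `a`. -/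
def State.contents (s : State) (a : ℕ) : List ℝ :=
  (List.range (s.int a)).map (s.arr a)

/-- The initial configuration for an input made of finitely many real sequences: the `k`-th one
fills the beginning of array `k`, its length is in integer register `k`, all else is `0`. -/
def State.init (x : List (List ℝ)) : State where
  int k := (x.getD k []).length
  real _ := 0
  arr k j := (x.getD k []).getD j 0

end RealRAM

/-- A decision problem on real data: instances, their size, their description by finitely many
finite sequences of reals, and the yes-instances. -/
structure Problem where
  Inst : Type
  size : Inst → ℕ
  enc : Inst → List (List ℝ)
  enc_injective : Function.Injective enc
  yes : Inst → Prop

namespace RealRAM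

/-- `Exec B p s s' t qs`: started in `s` with an oracle for the problem `B`, the program `p` halts
in `s'` after `t` unit-cost operations, and `qs` lists the sizes of the instances of `B` that it
submitted to the oracle. A call costs one operation (beside the operations that write down the
instance); there is no execution that submits anything but an instance of `B`.
In `loop b p`, the body `p` is repeated while the test `b` holds. -/
inductive Exec (B : Problem) : Prog → State → State → ℕ → List ℕ → Prop where
  | skip (s : State) : Exec B .skip s s 1 []
  | setI (s : State) (i : ℕ) (e : IExp) :
      Exec B (.setI i e) s (s.setInt i (e.eval s)) (e.cost + 1) []
  | setR (s : State) (i : ℕ) (e : RExp) :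
      Exec B (.setR i e) s (s.setReal i (e.eval s)) (e.cost + 1) []
  | store (s : State) (a : ℕ) (e : IExp) (v : RExp) :
      Exec B (.store a e v) s (s.setCell a (e.eval s) (v.eval s)) (e.cost + v.cost + 1) []
  | seq {p₁ p₂ : Prog} {s₁ s₂ s₃ : State} {t₁ t₂ : ℕ} {qs₁ qs₂ : List ℕ}
      (h₁ : Exec B p₁ s₁ s₂ t₁ qs₁) (h₂ : Exec B p₂ s₂ s₃ t₂ qs₂) :
      Exec B (.seq p₁ p₂) s₁ s₃ (t₁ + t₂) (qs₁ ++ qs₂)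
  | ite_true {b : BExp} {p₁ p₂ : Prog} {s s' : State} {t : ℕ} {qs : List ℕ}
      (hb : b.holds s) (h : Exec B p₁ s s' t qs) :
      Exec B (.ite b p₁ p₂) s s' (b.cost + t + 1) qs
  | ite_false {b : BExp} {p₁ p₂ : Prog} {s s' : State} {t : ℕ} {qs : List ℕ}
      (hb : ¬ b.holds s) (h : Exec B p₂ s s' t qs) :
      Exec B (.ite b p₁ p₂) s s' (b.cost + t + 1) qs
  | loop_done {b : BExp} {p : Prog} {s : State} (hb : ¬ b.holds s) :
      Exec B (.loop b p) s s (b.cost + 1) []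
  | loop_step {b : BExp} {p : Prog} {s₁ s₂ s₃ : State} {t₁ t₂ : ℕ} {qs₁ qs₂ : List ℕ}
      (hb : b.holds s₁) (h₁ : Exec B p s₁ s₂ t₁ qs₁) (h₂ : Exec B (.loop b p) s₂ s₃ t₂ qs₂) :
      Exec B (.loop b p) s₁ s₃ (b.cost + t₁ + 1 + t₂) (qs₁ ++ qs₂)
  | ask_yes {s : State} {as : List ℕ} {r : ℕ} {I : B.Inst}
      (henc : as.map s.contents = B.enc I) (hI : B.yes I) :
      Exec B (.ask as r) s (s.setInt r 1) 1 [B.size I]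
  | ask_no {s : State} {as : List ℕ} {r : ℕ} {I : B.Inst}
      (henc : as.map s.contents = B.enc I) (hI : ¬ B.yes I) :
      Exec B (.ask as r) s (s.setInt r 0) 1 [B.size I]

/-- Executions are deterministic. -/
theorem Exec.det {B : Problem} {p : Prog} {s s₁ s₂ : State} {t₁ t₂ : ℕ} {qs₁ qs₂ : List ℕ}
    (h₁ : Exec B p s s₁ t₁ qs₁) (h₂ : Exec B p s s₂ t₂ qs₂) :
    s₁ = s₂ ∧ t₁ = t₂ ∧ qs₁ = qs₂ := by
  induction h₁ generalizing s₂ t₂ qs₂ with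
  | skip | setI | setR | store => cases h₂; exact ⟨rfl, rfl, rfl⟩
  | seq _ _ ih₁ ih₂ =>
    cases h₂ with
    | seq k₁ k₂ =>
      obtain ⟨rfl, rfl, rfl⟩ := ih₁ k₁
      obtain ⟨rfl, rfl, rfl⟩ := ih₂ k₂
      exact ⟨rfl, rfl, rfl⟩
  | ite_true hb _ ih =>
    cases h₂ with
    | ite_true _ k => obtain ⟨rfl, rfl, rfl⟩ := ih k; exact ⟨rfl, rfl, rfl⟩
    | ite_false hb' _ => exact absurd hb hb'
  | ite_false hb _ ih =>
    cases h₂ with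
    | ite_true hb' _ => exact absurd hb' hb
    | ite_false _ k => obtain ⟨rfl, rfl, rfl⟩ := ih k; exact ⟨rfl, rfl, rfl⟩
  | loop_done hb =>
    cases h₂ with
    | loop_done _ => exact ⟨rfl, rfl, rfl⟩
    | loop_step hb' _ _ => exact absurd hb' hb
  | loop_step hb _ _ ih₁ ih₂ =>
    cases h₂ with
    | loop_done hb' => exact absurd hb hb'
    | loop_step _ k₁ k₂ =>
      obtain ⟨rfl, rfl, rfl⟩ := ih₁ k₁
      obtain ⟨rfl, rfl, rfl⟩ := ih₂ k₂
      exact ⟨rfl, rfl, rfl⟩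
  | ask_yes henc hI =>
    cases h₂ with
    | ask_yes henc' hI' =>
      obtain rfl := B.enc_injective (henc.symm.trans henc')
      exact ⟨rfl, rfl, rfl⟩
    | ask_no henc' hI' =>
      obtain rfl := B.enc_injective (henc.symm.trans henc')
      exact absurd hI hI'
  | ask_no henc hI =>
    cases h₂ with
    | ask_yes henc' hI' =>
      obtain rfl := B.enc_injective (henc.symm.trans henc')
      exact absurd hI' hI
    | ask_no henc' hI' =>
      obtain rfl := B.enc_injective (henc.symm.trans henc')
      exact ⟨rfl, rfl, rfl⟩

end RealRAM

/-- `A` is `f(n)`-solvable using `B`: one program solves every instance of `A` of size `n` by using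
at most `k` instances of `B`, of size at most `S n = O(n)`, and additional time at most
`T n = O(f(n))`. The answer is read off integer register `0`. -/
def SolvableUsing (A B : Problem) (f : ℕ → ℝ) : Prop :=
  ∃ (p : RealRAM.Prog) (k : ℕ) (S T : ℕ → ℕ),
    (fun n => (S n : ℝ)) =O[Filter.atTop] (fun n : ℕ => (n : ℝ)) ∧
    (fun n => (T n : ℝ)) =O[Filter.atTop] f ∧
    ∀ I : A.Inst, ∃ (s : RealRAM.State) (t : ℕ) (qs : List ℕ),
      RealRAM.Exec B p (RealRAM.State.init (A.enc I)) s t qs ∧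
      t ≤ T (A.size I) ∧ qs.length ≤ k ∧ (∀ q ∈ qs, q ≤ S (A.size I)) ∧
      (s.int 0 = 1 ↔ A.yes I)

/-! ### Segments containing points -/

/-- A set of `n` reals (in arbitrary order) and a set of `m ≤ c * n` pairwise disjoint closed
intervals `[a, b]`, `a ≤ b` (in arbitrary order). -/
structure SegContPntInst (c : ℕ) where
  pts : List ℝ
  segs : List (ℝ × ℝ)
  pts_nodup : pts.Nodup
  segs_le : ∀ q ∈ segs, q.1 ≤ q.2
  segs_disjoint : segs.Pairwise fun q q' => Disjoint (Set.Icc q.1 q.2) (Set.Icc q'.1 q'.2)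
  length_le : segs.length ≤ c * pts.length

theorem pairList_ext {l l' : List (ℝ × ℝ)} (h₁ : l.map Prod.fst = l'.map Prod.fst)
    (h₂ : l.map Prod.snd = l'.map Prod.snd) : l = l' := by
  rw [← List.zip_unzip l, ← List.zip_unzip l', List.unzip_eq_map, List.unzip_eq_map, h₁, h₂]

/-- Is there a translation of the points that makes them contained in the union of the
intervals? -/
def SegContPnt (c : ℕ) : Problem where
  Inst := SegContPntInst c
  size I := I.pts.length
  enc I := [I.pts, I.segs.map Prod.fst, I.segs.map Prod.snd]
  enc_injective := by
    rintro ⟨p, s, _, _, _, _⟩ ⟨p', s', _, _, _, _⟩ h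
    simp only [List.cons.injEq, and_true] at h
    obtain ⟨rfl, h₁, h₂⟩ := h
    obtain rfl := pairList_ext h₁ h₂
    rfl
  yes I := ∃ v : ℝ, (fun x => x + v) '' {x | x ∈ I.pts} ⊆ ⋃ q ∈ I.segs, Set.Icc q.1 q.2

/-! ### Containment of convex polygons in the plane `ℂ` -/

/-- Twice the signed area of the triangle `u v w`; positive iff it is a left turn. -/
def orient (u v w : ℂ) : ℝ :=
  (v.re - u.re) * (w.im - u.im) - (v.im - u.im) * (w.re - u.re)

/-- A convex polygon, given by its vertices (none of them redundant) in counterclockwise order;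
it has as many edges as vertices. -/
structure ConvPoly where
  verts : List ℂ
  three_le : 3 ≤ verts.length
  convex : ∀ (i j k : ℕ) (_ : i < j) (_ : j < k) (_ : k < verts.length),
    0 < orient verts[i] verts[j] verts[k]

/-- The closed region bounded by the polygon. -/
def ConvPoly.region (P : ConvPoly) : Set ℂ :=
  convexHull ℝ {z | z ∈ P.verts}

def ConvPoly.edges (P : ConvPoly) : ℕ :=
  P.verts.length

/-- Convex polygons `P`, `Q` with `n` and `m ≤ c * n` edges. -/
structure ConvPolyContInst (c : ℕ) where
  P : ConvPoly
  Q : ConvPoly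
  edges_le : Q.edges ≤ c * P.edges

/-- The coordinates of the vertices of both polygons. -/
def ConvPolyContInst.enc {c : ℕ} (I : ConvPolyContInst c) : List (List ℝ) :=
  [I.P.verts.map Complex.re, I.P.verts.map Complex.im,
    I.Q.verts.map Complex.re, I.Q.verts.map Complex.im]

theorem complexList_ext {l l' : List ℂ} (h₁ : l.map Complex.re = l'.map Complex.re)
    (h₂ : l.map Complex.im = l'.map Complex.im) : l = l' := by
  have e : Function.Injective (fun z : ℂ => (z.re, z.im)) := fun z w h =>
    Complex.ext (Prod.ext_iff.1 h).1 (Prod.ext_iff.1 h).2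
  apply List.map_injective_iff.2 e
  apply pairList_ext <;> simpa [Function.comp_def] using by assumption

theorem ConvPolyContInst.enc_injective {c : ℕ} :
    Function.Injective (ConvPolyContInst.enc (c := c)) := by
  rintro ⟨⟨p, _, _⟩, ⟨q, _, _⟩, _⟩ ⟨⟨p', _, _⟩, ⟨q', _, _⟩, _⟩ h
  simp only [ConvPolyContInst.enc, List.cons.injEq, and_true] at h
  obtain ⟨h₁, h₂, h₃, h₄⟩ := h
  obtain rfl := complexList_ext h₁ h₂
  obtain rfl := complexList_ext h₃ h₄
  rfl

/-- Is there a rotation of `P` around the origin that makes it contained in `Q`? -/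
def ConvPolyContRot (c : ℕ) : Problem where
  Inst := ConvPolyContInst c
  size I := I.P.edges
  enc := ConvPolyContInst.enc
  enc_injective := ConvPolyContInst.enc_injective
  yes I := ∃ w : Circle, (fun z => rotation w z) '' I.P.region ⊆ I.Q.region

/-- Is there a rigid motion (rotation followed by translation) of `P` that makes it contained
in `Q`? -/
def ConvPolyContRigidMot (c : ℕ) : Problem where
  Inst := ConvPolyContInst c
  size I := I.P.edges
  enc := ConvPolyContInst.enc
  enc_injective := ConvPolyContInst.enc_injective
  yes I := ∃ (w : Circle) (t : ℂ), (fun z => rotation w z + t) '' I.P.region ⊆ I.Q.region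

/-! The line is wrapped around the unit circle. All data are divided by a factor larger than the
spread of the points plus the spread of the intervals. Points become angles, intervals become arcs,
and the two spreads together stay below `π`. A shift that works modulo `π` then uses the same
multiple of `π` for every point, so it comes from a translation of the line
(`SortedSegs.exists_translate_mod_pi_iff`).

Each point and each arc is accompanied by its antipode. The polygon `P` is the convex hull of the
points. The polygon `Q` is bounded by the lines through the chords that span the gaps between
neighbouring arcs. Such a line cuts off from the circle exactly the open gap, so `Q` meets the
circle precisely in the arcs (`GapSystem.cis_mem_region_iff`). A single-point arc becomes a vertex
of `Q`. Under rotation the vertices of `P` stay on the circle, so a rotated `P` lies in `Q` iff its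
vertices lie in the arcs (`AngleSystem.exists_rotation_iff`).

The antipodes serve twice. With at least two arcs, the directions of consecutive gap chords turn by
less than `π`, so the lines do bound a convex polygon. Moreover both polygons are centrally
symmetric: averaging a contained copy of `P` with its point reflection removes any translation
(`AngleSystem.exists_rigidMotion_iff`).

The order of points and arcs is needed to find the gaps, and sorting them takes the time `n log n`.
Left and right end points may be sorted independently, since for disjoint intervals both orders
agree (`SegContPntInst.sorted`). The remaining work is linear, and `π` is never computed, because
adding `π` to an angle negates the coordinates. One question of size `2 * n` is asked; instances
with fewer than two points or intervals are answered directly. -/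

/-! ### Plane geometry -/

/-- The cross product of two plane vectors. -/
def cross (z w : ℂ) : ℝ := z.re * w.im - z.im * w.re

theorem orient_eq_cross (u v w : ℂ) : orient u v w = cross (v - u) (w - u) := by
  simp [orient, cross]

theorem orient_rotate (u v w : ℂ) : orient v w u = orient u v w := by
  simp only [orient]; ring

theorem orient_self_right (u v : ℂ) : orient u v v = 0 := by
  simp only [orient]; ring

theorem orient_self_left (u v : ℂ) : orient u v u = 0 := by
  simp only [orient]; ring

/-- The set of points on or to the left of a directed line is convex. -/
theorem convex_orient_nonneg (u v : ℂ) : Convex ℝ {z | 0 ≤ orient u v z} := by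
  intro x hx y hy s t hs ht hst
  have : orient u v (s • x + t • y) = s * orient u v x + t * orient u v y := by
    obtain rfl : s = 1 - t := by linarith
    simp only [orient, Complex.add_re, Complex.add_im, Complex.real_smul, Complex.mul_re,
      Complex.mul_im, Complex.ofReal_re, Complex.ofReal_im]
    ring
  rw [Set.mem_ofPred_eq, this]
  exact add_nonneg (mul_nonneg hs hx) (mul_nonneg ht hy)

/-- A point on the left of all sides of a triangle lies in every convex set containing the
vertices. -/
theorem Convex.mem_of_orient_nonneg {S : Set ℂ} (hS : Convex ℝ S) {p q r z : ℂ} (hp : p ∈ S)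
    (hq : q ∈ S) (hr : r ∈ S) (h : 0 < orient p q r) (h₁ : 0 ≤ orient q r z)
    (h₂ : 0 ≤ orient r p z) (h₃ : 0 ≤ orient p q z) : z ∈ S := by
  -- The barycentric coordinates of `z` are the ratios of the areas of the triangles that `z` spans
  -- with the sides to the area of the whole triangle.
  have key := hS.sum_mem (t := Finset.univ)
    (w := ![orient q r z / orient p q r, orient r p z / orient p q r, orient p q z / orient p q r])
    (z := ![p, q, r])
    (by intro i _; fin_cases i <;> simp <;> positivity)
    (by
      simp only [Fin.sum_univ_three, Matrix.cons_val_zero, Matrix.cons_val_one, Matrix.cons_val]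
      field_simp
      simp only [orient]; ring)
    (by intro i _; fin_cases i <;> simpa)
  convert key using 1
  simp only [Fin.sum_univ_three, Matrix.cons_val_zero, Matrix.cons_val_one, Matrix.cons_val]
  apply Complex.ext
  · simp only [Complex.add_re, Complex.real_smul, Complex.mul_re, Complex.ofReal_re,
      Complex.ofReal_im]
    field_simp
    simp only [orient]; ring
  · simp only [Complex.add_im, Complex.real_smul, Complex.mul_im, Complex.ofReal_re,
      Complex.ofReal_im]
    field_simp
    simp only [orient]; ring

theorem ConvPoly.convex_region (P : ConvPoly) : Convex ℝ P.region :=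
  convex_convexHull ℝ _

/-! ### Points and chords of the unit circle -/

/-- The point of the unit circle with argument `θ`. -/
noncomputable def cis (θ : ℝ) : ℂ := ⟨Real.cos θ, Real.sin θ⟩

theorem cis_add_pi (θ : ℝ) : cis (θ + Real.pi) = -cis θ := by
  apply Complex.ext <;> simp [cis]

theorem cis_add_two_pi (θ : ℝ) : cis (θ + 2 * Real.pi) = cis θ := by
  apply Complex.ext <;> simp [cis]

theorem cis_add (x y : ℝ) : cis (x + y) = cis y * cis x := by
  apply Complex.ext <;> simp [cis, Real.cos_add, Real.sin_add] <;> ring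

theorem cis_eq_exp (x : ℝ) : cis x = Circle.exp x := by
  rw [Circle.coe_exp, Complex.exp_mul_I, ← Complex.ofReal_cos, ← Complex.ofReal_sin]
  apply Complex.ext <;> simp [cis, -Complex.ofReal_cos, -Complex.ofReal_sin]

theorem cis_eq_cis_iff {x y : ℝ} : cis x = cis y ↔ ∃ k : ℤ, x = y + k * (2 * Real.pi) := by
  rw [cis_eq_exp, cis_eq_exp, Circle.coe_inj, Circle.exp_eq_exp]

theorem exists_cis_eq_circle (w : Circle) : ∃ v : ℝ, (w : ℂ) = cis v :=
  ⟨_, by rw [cis_eq_exp, Circle.exp_arg]⟩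

theorem sin_two_add_sin_two_sub (x y : ℝ) :
    Real.sin (2 * x) + Real.sin (2 * y) - Real.sin (2 * (x + y)) =
      4 * Real.sin x * Real.sin y * Real.sin (x + y) := by
  simp only [Real.sin_two_mul, Real.sin_add, Real.cos_add]
  have hx := Real.sin_sq_add_cos_sq x
  have hy := Real.sin_sq_add_cos_sq y
  linear_combination (-2 * Real.sin y * Real.cos y) * hx + (-2 * Real.sin x * Real.cos x) * hy

/-- Expanding gives a sum of sines of the three differences; the product form makes the sign
readable from the cyclic order of the angles. -/
theorem orient_cis (a b c : ℝ) : orient (cis a) (cis b) (cis c) =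
    4 * Real.sin ((b - a) / 2) * Real.sin ((c - b) / 2) * Real.sin ((c - a) / 2) := by
  have h := sin_two_add_sin_two_sub ((b - a) / 2) ((c - b) / 2)
  rw [show (b - a) / 2 + (c - b) / 2 = (c - a) / 2 by ring] at h
  rw [← h, mul_div_cancel₀ _ two_ne_zero, mul_div_cancel₀ _ two_ne_zero,
    mul_div_cancel₀ _ two_ne_zero, Real.sin_sub, Real.sin_sub, Real.sin_sub]
  simp only [orient, cis]
  ring

/-- The cross product of two chords of the unit circle. -/
theorem cross_chords (a b c d : ℝ) : cross (cis b - cis a) (cis d - cis c) =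
    4 * Real.sin ((b - a) / 2) * Real.sin ((d - c) / 2) * Real.sin ((c + d - a - b) / 2) := by
  -- A chord is `2 * sin ((b - a) / 2)` times the unit vector of argument `(a + b) / 2 + π / 2`, so
  -- the cross product depends only on the half lengths and the difference of the mid-angles.
  have e₁ : cis b - cis a = ⟨-2 * Real.sin ((b + a) / 2) * Real.sin ((b - a) / 2),
      2 * Real.sin ((b - a) / 2) * Real.cos ((b + a) / 2)⟩ := by
    apply Complex.ext <;> simp [cis, Real.cos_sub_cos, Real.sin_sub_sin]
  have e₂ : cis d - cis c = ⟨-2 * Real.sin ((d + c) / 2) * Real.sin ((d - c) / 2),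
      2 * Real.sin ((d - c) / 2) * Real.cos ((d + c) / 2)⟩ := by
    apply Complex.ext <;> simp [cis, Real.cos_sub_cos, Real.sin_sub_sin]
  rw [e₁, e₂, show (c + d - a - b) / 2 = (d + c) / 2 - (b + a) / 2 by ring, Real.sin_sub]
  simp only [cross]
  ring

theorem orient_cis_pos {a b c : ℝ} (hab : a < b) (hbc : b < c) (hca : c < a + 2 * Real.pi) :
    0 < orient (cis a) (cis b) (cis c) := by
  rw [orient_cis]
  have := Real.sin_pos_of_pos_of_lt_pi (x := (b - a) / 2) (by linarith) (by linarith)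
  have := Real.sin_pos_of_pos_of_lt_pi (x := (c - b) / 2) (by linarith) (by linarith)
  have := Real.sin_pos_of_pos_of_lt_pi (x := (c - a) / 2) (by linarith) (by linarith)
  positivity

theorem orient_cis_nonneg {a b c : ℝ} (hab : a ≤ b) (hbc : b ≤ c) (hca : c ≤ a + 2 * Real.pi) :
    0 ≤ orient (cis a) (cis b) (cis c) := by
  rw [orient_cis]
  have := Real.sin_nonneg_of_nonneg_of_le_pi (x := (b - a) / 2) (by linarith) (by linarith)
  have := Real.sin_nonneg_of_nonneg_of_le_pi (x := (c - b) / 2) (by linarith) (by linarith)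
  have := Real.sin_nonneg_of_nonneg_of_le_pi (x := (c - a) / 2) (by linarith) (by linarith)
  positivity

theorem cross_smul_left (r : ℝ) (z w : ℂ) : cross (r • z) w = r * cross z w := by
  simp only [cross, Complex.real_smul, Complex.mul_re, Complex.mul_im, Complex.ofReal_re,
    Complex.ofReal_im]
  ring

theorem cross_smul_right (r : ℝ) (z w : ℂ) : cross z (r • w) = r * cross z w := by
  simp only [cross, Complex.real_smul, Complex.mul_re, Complex.mul_im, Complex.ofReal_re,
    Complex.ofReal_im]
  ring

theorem cross_add_left (x y z : ℂ) : cross (x + y) z = cross x z + cross y z := by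
  simp only [cross, Complex.add_re, Complex.add_im]
  ring

theorem cross_add_right (x y z : ℂ) : cross x (y + z) = cross x y + cross x z := by
  simp only [cross, Complex.add_re, Complex.add_im]
  ring

/-! ### The polygon cutting off the gaps of a system of arcs -/

/-- Increasing disjoint intervals `[a i, b i]`, repeated with period `π` after `m` of them. -/
structure GapSystem (m : ℕ) (a b : ℕ → ℝ) : Prop where
  two_le : 2 ≤ m
  le : ∀ i, a i ≤ b i
  lt : ∀ i, b i < a (i + 1)
  left_add : ∀ i, a (i + m) = a i + Real.pi
  right_add : ∀ i, b (i + m) = b i + Real.pi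

/-- The chord over the gap between the `i`-th interval and the next. -/
noncomputable def gapChord (a b : ℕ → ℝ) (i : ℕ) : ℂ :=
  cis (a (i + 1)) - cis (b i)

/-- The intersection point of the lines carrying two consecutive gap chords. -/
noncomputable def gapVertex (a b : ℕ → ℝ) (i : ℕ) : ℂ :=
  cis (a (i + 1)) + (cross (cis (b (i + 1)) - cis (a (i + 1))) (gapChord a b (i + 1)) /
    cross (gapChord a b i) (gapChord a b (i + 1))) • gapChord a b i

namespace GapSystem

variable {m : ℕ} {a b : ℕ → ℝ}

theorem strictMono_left (h : GapSystem m a b) : StrictMono a :=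
  strictMono_nat_of_lt_succ fun i => (h.le i).trans_lt (h.lt i)

theorem strictMono_right (h : GapSystem m a b) : StrictMono b :=
  strictMono_nat_of_lt_succ fun i => (h.lt i).trans_le (h.le (i + 1))

theorem left_add_two (h : GapSystem m a b) (i : ℕ) : a (i + 2 * m) = a i + 2 * Real.pi := by
  rw [two_mul, ← add_assoc, h.left_add, h.left_add]; ring

theorem right_add_two (h : GapSystem m a b) (i : ℕ) : b (i + 2 * m) = b i + 2 * Real.pi := by
  rw [two_mul, ← add_assoc, h.right_add, h.right_add]; ring

/-- This is where two intervals per period are needed: with only one, the next left end would be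
exactly `π` away. -/
theorem left_lt_add_pi (h : GapSystem m a b) (i : ℕ) : a (i + 1) < a i + Real.pi := by
  rw [← h.left_add]; exact h.strictMono_left (by have := h.two_le; omega)

theorem right_lt_add_pi (h : GapSystem m a b) (i : ℕ) : b (i + 1) < b i + Real.pi := by
  rw [← h.right_add]; exact h.strictMono_right (by have := h.two_le; omega)

/-- The direction of a gap chord is a quarter turn ahead of the middle of its gap. In fewer than `m`
steps this middle advances by less than `π`, so the chords keep turning left. -/
theorem cross_gapChord_pos (h : GapSystem m a b) {i j : ℕ} (hij : i < j) (hj : j < i + m) :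
    0 < cross (gapChord a b i) (gapChord a b j) := by
  rw [gapChord, gapChord, cross_chords]
  have h1 := h.lt i
  have h2 := h.lt j
  have h3 := h.left_lt_add_pi i
  have h4 := h.left_lt_add_pi j
  have h5 := h.le i
  have h6 := h.le j
  have h7 := h.strictMono_left (show i + 1 < j + 1 by omega)
  have h8 := h.strictMono_right hij
  have h9 := h.strictMono_left (show j + 1 < i + 1 + m by omega)
  have h10 := h.strictMono_right hj
  rw [h.left_add] at h9
  rw [h.right_add] at h10
  have hpi := Real.pi_pos
  have := Real.sin_pos_of_pos_of_lt_pi (x := (a (i + 1) - b i) / 2) (by linarith) (by linarith)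
  have := Real.sin_pos_of_pos_of_lt_pi (x := (a (j + 1) - b j) / 2) (by linarith) (by linarith)
  have := Real.sin_pos_of_pos_of_lt_pi (x := (b j + a (j + 1) - b i - a (i + 1)) / 2)
    (by linarith) (by linarith)
  positivity

theorem gapChord_add (h : GapSystem m a b) (i : ℕ) :
    gapChord a b (i + m) = -gapChord a b i := by
  simp only [gapChord, show i + m + 1 = i + 1 + m by omega, h.left_add, h.right_add, cis_add_pi]
  ring

theorem gapVertex_add (h : GapSystem m a b) (i : ℕ) :
    gapVertex a b (i + m) = -gapVertex a b i := by
  have e : i + m + 1 = i + 1 + m := by omega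
  simp only [gapVertex, e, h.gapChord_add, h.left_add, h.right_add, cis_add_pi]
  have e₁ : cross (-cis (b (i + 1)) - -cis (a (i + 1))) (-gapChord a b (i + 1)) =
      cross (cis (b (i + 1)) - cis (a (i + 1))) (gapChord a b (i + 1)) := by
    simp only [cross, Complex.neg_re, Complex.neg_im, Complex.sub_re, Complex.sub_im]; ring
  have e₂ : cross (-gapChord a b i) (-gapChord a b (i + 1)) =
      cross (gapChord a b i) (gapChord a b (i + 1)) := by
    simp only [cross, Complex.neg_re, Complex.neg_im]; ring
  rw [e₁, e₂, smul_neg, neg_add]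

/-- The vertex lies on the extension of the chord beyond its end. The numerator of the factor is the
oriented area of the triangle formed by the arc's two ends and the next arc's left end; it is
positive unless the arc is a single point. -/
theorem gapVertex_eq_left (h : GapSystem m a b) (i : ℕ) :
    ∃ t : ℝ, 0 ≤ t ∧ (a (i + 1) < b (i + 1) → 0 < t) ∧
      gapVertex a b i = cis (a (i + 1)) + t • gapChord a b i := by
  have hc := h.cross_gapChord_pos (Nat.lt_succ_self i) (by have := h.two_le; omega)
  have e : cross (cis (b (i + 1)) - cis (a (i + 1))) (gapChord a b (i + 1)) =
      orient (cis (a (i + 1))) (cis (b (i + 1))) (cis (a (i + 1 + 1))) := by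
    simp only [cross, orient, gapChord, Complex.sub_re, Complex.sub_im]; ring
  have h1 := h.le (i + 1)
  have h2 := h.lt (i + 1)
  have h3 := h.left_lt_add_pi (i + 1)
  have hpi := Real.pi_pos
  refine ⟨_, div_nonneg ?_ hc.le, fun hlt => div_pos ?_ hc, rfl⟩
  · rw [e]; exact orient_cis_nonneg h1 h2.le (by linarith)
  · rw [e]; exact orient_cis_pos hlt h2 (by linarith)

/-- The same vertex seen from the second line: Cramer's rule for the intersection, solved for the
other parameter. -/
theorem gapVertex_eq_right (h : GapSystem m a b) (i : ℕ) :
    ∃ t : ℝ, 0 ≤ t ∧ (a (i + 1) < b (i + 1) → 0 < t) ∧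
      gapVertex a b i = cis (b (i + 1)) - t • gapChord a b (i + 1) := by
  have hc := h.cross_gapChord_pos (Nat.lt_succ_self i) (by have := h.two_le; omega)
  have e : cross (gapChord a b i) (cis (b (i + 1)) - cis (a (i + 1))) =
      orient (cis (b i)) (cis (a (i + 1))) (cis (b (i + 1))) := by
    simp only [cross, orient, gapChord, Complex.sub_re, Complex.sub_im]; ring
  have h1 := h.le (i + 1)
  have h2 := h.lt i
  have h3 := h.right_lt_add_pi i
  have hpi := Real.pi_pos
  refine ⟨cross (gapChord a b i) (cis (b (i + 1)) - cis (a (i + 1))) /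
    cross (gapChord a b i) (gapChord a b (i + 1)), div_nonneg ?_ hc.le,
    fun hlt => div_pos ?_ hc, ?_⟩
  · rw [e]; exact orient_cis_nonneg h2.le h1 (by linarith)
  · rw [e]; exact orient_cis_pos h2 hlt (by linarith)
  · have hc' := hc.ne'
    rw [gapVertex]
    generalize gapChord a b i = d at *
    generalize gapChord a b (i + 1) = d' at *
    generalize cis (a (i + 1)) = α at *
    generalize cis (b (i + 1)) = β at *
    apply Complex.ext
    · simp only [Complex.add_re, Complex.sub_re, Complex.real_smul, Complex.mul_re,
        Complex.ofReal_re, Complex.ofReal_im]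
      field_simp
      simp only [cross, Complex.sub_re, Complex.sub_im]; ring
    · simp only [Complex.add_im, Complex.sub_im, Complex.real_smul, Complex.mul_im,
        Complex.ofReal_re, Complex.ofReal_im]
      field_simp
      simp only [cross, Complex.sub_re, Complex.sub_im]; ring

/-- The edges of the polygon are positive multiples of the gap chords. -/
theorem gapVertex_succ_sub (h : GapSystem m a b) (i : ℕ) :
    ∃ r : ℝ, 0 < r ∧ gapVertex a b (i + 1) - gapVertex a b i = r • gapChord a b (i + 1) := by
  obtain ⟨t, ht, -, e⟩ := h.gapVertex_eq_left (i + 1)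
  obtain ⟨t', ht', -, e'⟩ := h.gapVertex_eq_right i
  -- The edge consists of the chord itself and its extensions at both ends.
  refine ⟨1 + t + t', by positivity, ?_⟩
  have e'' : gapChord a b (i + 1) = cis (a (i + 1 + 1)) - cis (b (i + 1)) := rfl
  rw [e, e', add_smul, add_smul, one_smul]
  linear_combination -e''

/-- The difference of the vertices is a sum of edges, each a positive multiple of a gap chord less
than `m` steps after chord `s + 1`. -/
theorem cross_gapChord_gapVertex_pos (h : GapSystem m a b) {s j k : ℕ} (hsj : s < j)
    (hjk : j < k) (hk : k ≤ s + m) :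
    0 < cross (gapChord a b (s + 1)) (gapVertex a b k - gapVertex a b j) := by
  have key : ∀ l, j ≤ l → l < s + m →
      0 < cross (gapChord a b (s + 1)) (gapVertex a b (l + 1) - gapVertex a b l) := by
    intro l hl hls
    obtain ⟨r, hr, e⟩ := h.gapVertex_succ_sub l
    rw [e, cross_smul_right]
    exact mul_pos hr (h.cross_gapChord_pos (by omega) (by omega))
  induction k, hjk using Nat.le_induction with
  | base => exact key j le_rfl (by omega)
  | succ k hjk ih =>
    have := key k (by omega) (by omega)
    rw [show gapVertex a b (k + 1) - gapVertex a b j = (gapVertex a b k - gapVertex a b j) +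
      (gapVertex a b (k + 1) - gapVertex a b k) by ring, cross_add_right]
    exact add_pos (ih (by omega)) this

/-- Within half a turn every edge before `j` has positive cross product with every edge after `j`;
bilinearity adds these up. -/
theorem orient_gapVertex_pos_of_le (h : GapSystem m a b) {i j k : ℕ} (hij : i < j)
    (hjk : j < k) (hk : k ≤ i + m) :
    0 < orient (gapVertex a b i) (gapVertex a b j) (gapVertex a b k) := by
  have e : orient (gapVertex a b i) (gapVertex a b j) (gapVertex a b k) =
      cross (gapVertex a b j - gapVertex a b i) (gapVertex a b k - gapVertex a b j) := by
    simp only [orient, cross, Complex.sub_re, Complex.sub_im]; ring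
  rw [e]
  clear e
  have key : ∀ l, i ≤ l → l < j → 0 < cross (gapVertex a b (l + 1) - gapVertex a b l)
      (gapVertex a b k - gapVertex a b j) := by
    intro l hl hlj
    obtain ⟨r, hr, e⟩ := h.gapVertex_succ_sub l
    rw [e, cross_smul_left]
    exact mul_pos hr (h.cross_gapChord_gapVertex_pos hlj hjk (by omega))
  suffices H : ∀ l, i + 1 ≤ l → l ≤ j → 0 < cross (gapVertex a b l - gapVertex a b i)
      (gapVertex a b k - gapVertex a b j) from H j hij le_rfl
  intro l hl
  induction l, hl using Nat.le_induction with
  | base => exact fun _ => key i le_rfl hij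
  | succ l hl ih =>
    intro hlj
    rw [show gapVertex a b (l + 1) - gapVertex a b i = (gapVertex a b l - gapVertex a b i) +
      (gapVertex a b (l + 1) - gapVertex a b l) by ring, cross_add_left]
    exact add_pos (ih (by omega)) (key l (by omega) (by omega))

/-- Taking the antipode of vertex `i` as third point of the triangle gives twice the cross product.
-/
theorem cross_gapVertex_pos (h : GapSystem m a b) {i j : ℕ} (hij : i < j) (hj : j < i + m) :
    0 < cross (gapVertex a b i) (gapVertex a b j) := by
  have := h.orient_gapVertex_pos_of_le hij hj le_rfl
  rw [h.gapVertex_add] at this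
  simp only [orient, Complex.neg_re, Complex.neg_im] at this
  simp only [cross]
  linarith

theorem gapVertex_add_two (h : GapSystem m a b) (i : ℕ) :
    gapVertex a b (i + 2 * m) = gapVertex a b i := by
  rw [two_mul, ← add_assoc, h.gapVertex_add, h.gapVertex_add, neg_neg]

/-- If one of the three cyclic index distances is at least `m`, the other two fit into half a turn
and a cyclic permutation suffices. Otherwise the area of the triangle is split at the origin into
three positive areas. -/
theorem orient_gapVertex_pos (h : GapSystem m a b) {i j k : ℕ} (hij : i < j) (hjk : j < k)
    (hk : k < i + 2 * m) :
    0 < orient (gapVertex a b i) (gapVertex a b j) (gapVertex a b k) := by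
  by_cases h1 : k ≤ i + m
  · exact h.orient_gapVertex_pos_of_le hij hjk h1
  by_cases h2 : i + 2 * m ≤ j + m
  · rw [← orient_rotate, ← h.gapVertex_add_two i]
    exact h.orient_gapVertex_pos_of_le hjk hk h2
  by_cases h3 : j + 2 * m ≤ k + m
  · rw [← orient_rotate, ← orient_rotate, ← h.gapVertex_add_two i, ← h.gapVertex_add_two j]
    exact h.orient_gapVertex_pos_of_le hk (by omega) h3
  have e : orient (gapVertex a b i) (gapVertex a b j) (gapVertex a b k) =
      cross (gapVertex a b i) (gapVertex a b j) + cross (gapVertex a b j) (gapVertex a b k) +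
      cross (gapVertex a b k) (gapVertex a b (i + 2 * m)) := by
    rw [h.gapVertex_add_two]
    simp only [orient, cross]; ring
  rw [e]
  have := h.cross_gapVertex_pos hij (by omega)
  have := h.cross_gapVertex_pos hjk (by omega)
  have := h.cross_gapVertex_pos hk (by omega)
  positivity

/-- The convex polygon bounded by the lines that carry the gap chords. -/
noncomputable def polygon (h : GapSystem m a b) : ConvPoly where
  verts := (List.range (2 * m)).map (gapVertex a b)
  three_le := by have := h.two_le; simp; omega
  convex := by
    intro i j k hij hjk hk
    simp only [List.length_map, List.length_range] at hk
    simp only [List.getElem_map, List.getElem_range]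
    exact h.orient_gapVertex_pos hij hjk (by omega)

theorem gapVertex_mem_region (h : GapSystem m a b) (i : ℕ) :
    gapVertex a b i ∈ h.polygon.region := by
  have hm := h.two_le
  have e : gapVertex a b i = gapVertex a b (i % (2 * m)) := by
    conv_lhs => rw [← Nat.mod_add_div i (2 * m)]
    induction i / (2 * m) with
    | zero => simp
    | succ k ih => rw [Nat.mul_succ, ← add_assoc, h.gapVertex_add_two, ih]
  rw [e]
  refine subset_convexHull ℝ _ (List.mem_map.2 ⟨_, List.mem_range.2 (Nat.mod_lt _ ?_), rfl⟩)
  omega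

theorem region_subset_halfPlane (h : GapSystem m a b) (i : ℕ) (hi : i < 2 * m) :
    h.polygon.region ⊆ {z | 0 ≤ orient (gapVertex a b i) (gapVertex a b (i + 1)) z} := by
  refine convexHull_min ?_ (convex_orient_nonneg _ _)
  rintro z hz
  obtain ⟨k, hk, rfl⟩ := List.mem_map.1 hz
  rw [List.mem_range] at hk
  rw [Set.mem_ofPred_eq]
  rcases lt_trichotomy k i with hki | rfl | hki
  · rcases Nat.lt_or_ge (i + 1) (k + 2 * m) with h1 | h1
    · rw [orient_rotate]
      exact (h.orient_gapVertex_pos hki (Nat.lt_succ_self i) h1).le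
    · obtain rfl : k = 0 := by omega
      rw [show i + 1 = 0 + 2 * m by omega, h.gapVertex_add_two, orient_self_right]
  · rw [orient_self_left]
  · rcases Nat.lt_or_ge (i + 1) k with h1 | h1
    · exact (h.orient_gapVertex_pos (Nat.lt_succ_self i) h1 (by omega)).le
    · obtain rfl : k = i + 1 := by omega
      rw [orient_self_right]

/-- No point of the unit circle inside a gap belongs to the polygon. -/
theorem not_mem_gap (h : GapSystem m a b) {i : ℕ} (hi : i < 2 * m) {ψ : ℝ}
    (hψ : cis ψ ∈ h.polygon.region) : ¬ (b (i + 1) < ψ ∧ ψ < a (i + 2)) := by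
  rintro ⟨h1, h2⟩
  have h0 := h.region_subset_halfPlane i hi hψ
  obtain ⟨r, hr, e⟩ := h.gapVertex_succ_sub i
  obtain ⟨t, -, -, e'⟩ := h.gapVertex_eq_right i
  -- The edge and the gap chord lie on the same line, so a point of the open gap is strictly to the
  -- right of the edge.
  have key : orient (gapVertex a b i) (gapVertex a b (i + 1)) (cis ψ) =
      -(r * orient (cis (b (i + 1))) (cis ψ) (cis (a (i + 2)))) := by
    rw [orient_eq_cross, e, cross_smul_left, e', gapChord]
    simp only [cross, orient, Complex.sub_re, Complex.sub_im, Complex.real_smul, Complex.mul_re,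
      Complex.mul_im, Complex.ofReal_re, Complex.ofReal_im]
    ring
  rw [Set.mem_ofPred_eq, key] at h0
  have h3 := h.le (i + 1)
  have h4 := h.left_lt_add_pi (i + 1)
  have h5 := Real.pi_pos
  have := mul_pos hr (orient_cis_pos h1 h2 (by linarith))
  linarith

/-- The ends of a gap chord lie on the edge that extends it; the weights are the ratios of the parts
into which they divide the edge. -/
theorem left_mem_region (h : GapSystem m a b) (i : ℕ) :
    cis (a (i + 2)) ∈ h.polygon.region := by
  obtain ⟨t, ht, -, e⟩ := h.gapVertex_eq_left (i + 1)
  obtain ⟨t', ht', -, e'⟩ := h.gapVertex_eq_right i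
  have e'' : gapChord a b (i + 1) = cis (a (i + 2)) - cis (b (i + 1)) := rfl
  have key := h.polygon.convex_region (h.gapVertex_mem_region i) (h.gapVertex_mem_region (i + 1))
    (a := t / (1 + t + t')) (b := (1 + t') / (1 + t + t')) (by positivity) (by positivity)
    (by field_simp; ring)
  convert key using 1
  rw [e, e', e'']
  apply Complex.ext
  · simp only [Complex.add_re, Complex.sub_re, Complex.real_smul, Complex.mul_re,
      Complex.ofReal_re, Complex.ofReal_im]
    field_simp
    ring
  · simp only [Complex.add_im, Complex.sub_im, Complex.real_smul, Complex.mul_im,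
      Complex.ofReal_re, Complex.ofReal_im]
    field_simp
    ring

theorem right_mem_region (h : GapSystem m a b) (i : ℕ) :
    cis (b (i + 1)) ∈ h.polygon.region := by
  obtain ⟨t, ht, -, e⟩ := h.gapVertex_eq_left (i + 1)
  obtain ⟨t', ht', -, e'⟩ := h.gapVertex_eq_right i
  have e'' : gapChord a b (i + 1) = cis (a (i + 2)) - cis (b (i + 1)) := rfl
  have key := h.polygon.convex_region (h.gapVertex_mem_region i) (h.gapVertex_mem_region (i + 1))
    (a := (1 + t) / (1 + t + t')) (b := t' / (1 + t + t')) (by positivity) (by positivity)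
    (by field_simp)
  convert key using 1
  rw [e, e', e'']
  apply Complex.ext
  · simp only [Complex.add_re, Complex.sub_re, Complex.real_smul, Complex.mul_re,
      Complex.ofReal_re, Complex.ofReal_im]
    field_simp
    ring
  · simp only [Complex.add_im, Complex.sub_im, Complex.real_smul, Complex.mul_im,
      Complex.ofReal_re, Complex.ofReal_im]
    field_simp
    ring

/-- The arcs belong to the polygon. -/
theorem arc_subset_region (h : GapSystem m a b) (i : ℕ) {θ : ℝ}
    (hθ : θ ∈ Set.Icc (a (i + 2)) (b (i + 2))) : cis θ ∈ h.polygon.region := by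
  have hα := h.left_mem_region i
  rcases hθ.1.eq_or_lt with heq | h1
  · rwa [← heq]
  have hlt := h1.trans_le hθ.2
  obtain ⟨t, -, ht, e⟩ := h.gapVertex_eq_left (i + 1)
  obtain ⟨t', -, ht', e'⟩ := h.gapVertex_eq_right (i + 1)
  replace ht := ht hlt
  replace ht' := ht' hlt
  have hpi := Real.pi_pos
  have g1 := h.lt (i + 1)
  have g2 := h.lt (i + 2)
  have g3 := h.right_lt_add_pi (i + 1)
  have g4 := h.left_lt_add_pi (i + 2)
  have hc := h.cross_gapChord_pos (Nat.lt_succ_self (i + 1)) (by have := h.two_le; omega)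
  -- The arc lies in the triangle formed by its two ends and the vertex where the neighbouring chord
  -- lines meet. A single-point arc, whose triangle degenerates, has been settled above.
  refine h.polygon.convex_region.mem_of_orient_nonneg hα (h.gapVertex_mem_region (i + 1))
    (h.right_mem_region (i + 1)) ?_ ?_ ?_ ?_
  · rw [← orient_rotate, orient_eq_cross]
    have : cis (a (i + 2)) - gapVertex a b (i + 1) = (-t) • gapChord a b (i + 1) := by
      rw [e, neg_smul]; ring
    have e2 : cis (b (i + 2)) - gapVertex a b (i + 1) = t' • gapChord a b (i + 2) := by
      rw [e']; ring
    have e3 : cross (t' • gapChord a b (i + 2)) ((-t) • gapChord a b (i + 1)) =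
        t * t' * cross (gapChord a b (i + 1)) (gapChord a b (i + 2)) := by
      rw [cross_smul_left, cross_smul_right]
      simp only [cross]; ring
    rw [this, e2, e3]
    positivity
  · have : orient (gapVertex a b (i + 1)) (cis (b (i + 1 + 1))) (cis θ) =
        t' * orient (cis θ) (cis (b (i + 2))) (cis (a (i + 3))) := by
      rw [e', gapChord]
      simp only [orient, Complex.sub_re, Complex.sub_im, Complex.real_smul, Complex.mul_re,
        Complex.mul_im, Complex.ofReal_re, Complex.ofReal_im]
      ring
    rw [this]
    exact mul_nonneg ht'.le (orient_cis_nonneg hθ.2 g2.le (by linarith))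
  · rw [← orient_rotate]
    exact orient_cis_nonneg h1.le hθ.2 (by linarith)
  · have : orient (cis (a (i + 2))) (gapVertex a b (i + 1)) (cis θ) =
        t * orient (cis (b (i + 1))) (cis (a (i + 2))) (cis θ) := by
      rw [e, gapChord]
      simp only [orient, Complex.add_re, Complex.add_im, Complex.sub_re, Complex.sub_im,
        Complex.real_smul, Complex.mul_re, Complex.mul_im, Complex.ofReal_re, Complex.ofReal_im]
      ring
    rw [this]
    exact mul_nonneg ht.le (orient_cis_nonneg g1.le h1.le (by linarith [hθ.2]))

/-- The polygon meets the unit circle in the given arcs and their antipodes. -/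
theorem cis_mem_region_iff (h : GapSystem m a b) (ψ : ℝ) : cis ψ ∈ h.polygon.region ↔
    ∃ i < m, ∃ k : ℤ, ψ + k * Real.pi ∈ Set.Icc (a i) (b i) := by
  have hm := h.two_le
  have hpi := Real.pi_pos
  constructor
  · intro hψ
    -- The full turn starts at `a 1` because `not_mem_gap` speaks of the gaps after the arcs with
    -- index at least `1`.
    obtain ⟨k, hk, -⟩ := existsUnique_add_zsmul_mem_Ico (a := 2 * Real.pi) (by linarith) ψ (a 1)
    rw [zsmul_eq_mul] at hk
    have hψ' : cis (ψ + k * (2 * Real.pi)) ∈ h.polygon.region := by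
      rwa [cis_eq_cis_iff.2 ⟨k, rfl⟩]
    generalize hx : ψ + k * (2 * Real.pi) = x at hk hψ'
    have hx2 : x < a (1 + 2 * m) := by rw [h.left_add_two]; exact hk.2
    -- the last interval starting before `x`
    obtain ⟨j, hj1, hjm, hjx, hxj⟩ : ∃ j, 1 ≤ j ∧ j < 1 + 2 * m ∧ a j ≤ x ∧ x < a (j + 1) := by
      by_contra! hcon
      have : ∀ j, 1 ≤ j → j ≤ 1 + 2 * m → a j ≤ x := by
        intro j hj
        induction j, hj using Nat.le_induction with
        | base => exact fun _ => hk.1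
        | succ j hj ih => exact fun hj' => hcon j hj (by omega) (ih (by omega))
      exact absurd hx2 (not_lt.2 (this _ (by omega) le_rfl))
    obtain ⟨i, rfl⟩ : ∃ i, j = i + 1 := ⟨j - 1, by omega⟩
    have hxb : x ≤ b (i + 1) := by
      by_contra! hcon
      exact h.not_mem_gap (by omega) hψ' ⟨hcon, hxj⟩
    have hla := h.left_add
    have hra := h.right_add
    have red : ∀ j, ∃ i < m, ∃ k : ℤ, a j = a i + k * Real.pi ∧ b j = b i + k * Real.pi := by
      intro j
      induction j using Nat.strong_induction_on with
      | _ j ih =>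
        by_cases hj : j < m
        · exact ⟨j, hj, 0, by simp, by simp⟩
        · obtain ⟨i, hi, k, e1, e2⟩ := ih (j - m) (by omega)
          refine ⟨i, hi, k + 1, ?_, ?_⟩
          · rw [show j = j - m + m by omega, hla, e1]; push_cast; ring
          · rw [show j = j - m + m by omega, hra, e2]; push_cast; ring
    obtain ⟨l, hl, k', e1, e2⟩ := red (i + 1)
    refine ⟨l, hl, 2 * k - k', ?_⟩
    push_cast
    constructor <;> [rw [e1] at hjx; rw [e2] at hxb] <;> nlinarith
  · rintro ⟨i, hi, k, hk⟩
    -- An even multiple of `π` leads to the arc itself, an odd one to its antipode. Since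
    -- `arc_subset_region` covers indices from `2` on, these are taken as the arcs `i + 2 * m` and
    -- `i + m`.
    obtain ⟨k', e | e⟩ := Int.even_or_odd' k
    · have := h.arc_subset_region (i + 2 * m - 2) (θ := ψ + k * Real.pi + 2 * Real.pi) (by
        rw [show i + 2 * m - 2 + 2 = i + 2 * m by omega, h.left_add_two, h.right_add_two]
        exact ⟨by linarith [hk.1], by linarith [hk.2]⟩)
      rwa [cis_add_two_pi, cis_eq_cis_iff.2 ⟨k', show ψ + k * Real.pi = _ by
        rw [e]; push_cast; ring⟩] at this
    · have := h.arc_subset_region (i + m - 2) (θ := ψ + k * Real.pi + Real.pi) (by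
        rw [show i + m - 2 + 2 = i + m by omega, h.left_add, h.right_add]
        exact ⟨by linarith [hk.1], by linarith [hk.2]⟩)
      rwa [cis_eq_cis_iff.2 ⟨k' + 1, show ψ + k * Real.pi + Real.pi = _ by
        rw [e]; push_cast; ring⟩] at this

theorem neg_mem_region (h : GapSystem m a b) {z : ℂ} (hz : z ∈ h.polygon.region) :
    -z ∈ h.polygon.region := by
  have : h.polygon.region ⊆ -h.polygon.region := by
    refine convexHull_min ?_ h.polygon.convex_region.neg
    intro z hz
    obtain ⟨k, hk, rfl⟩ := List.mem_map.1 hz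
    rw [Set.mem_neg, ← h.gapVertex_add]
    exact h.gapVertex_mem_region _
  exact this hz

end GapSystem

/-! ### The inscribed polygon -/

/-- Angles `p 0 < ⋯ < p (n - 1) < p 0 + π`, repeated with period `π`. -/
structure AngleSystem (n : ℕ) (p : ℕ → ℝ) : Prop where
  two_le : 2 ≤ n
  lt : ∀ i, p i < p (i + 1)
  add : ∀ i, p (i + n) = p i + Real.pi

namespace AngleSystem

variable {n : ℕ} {p : ℕ → ℝ}

/-- The centrally symmetric polygon with the given vertices on the unit circle. -/
noncomputable def polygon (h : AngleSystem n p) : ConvPoly where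
  verts := (List.range (2 * n)).map fun i => cis (p i)
  three_le := by have := h.two_le; simp; omega
  convex := by
    intro i j k hij hjk hk
    simp only [List.length_map, List.length_range] at hk
    simp only [List.getElem_map, List.getElem_range]
    have hs := strictMono_nat_of_lt_succ h.lt
    refine orient_cis_pos (hs hij) (hs hjk) ?_
    have : p (i + n + n) = p i + 2 * Real.pi := by rw [h.add, h.add]; ring
    rw [← this]
    exact hs (by omega)

theorem cis_mem_region (h : AngleSystem n p) {i : ℕ} (hi : i < n) :
    cis (p i) ∈ h.polygon.region :=
  subset_convexHull ℝ _ (List.mem_map.2 ⟨i, List.mem_range.2 (by omega), rfl⟩)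

theorem neg_cis_mem_region (h : AngleSystem n p) {i : ℕ} (hi : i < n) :
    -cis (p i) ∈ h.polygon.region := by
  rw [← cis_add_pi, ← h.add]
  exact subset_convexHull ℝ _ (List.mem_map.2 ⟨i + n, List.mem_range.2 (by omega), rfl⟩)

variable {m : ℕ} {a b : ℕ → ℝ}

/-- By convexity only the vertices matter, and rotation keeps them on the unit circle, where the
second polygon is known. The antipodal half follows by central symmetry. -/
theorem exists_rotation_iff (h : AngleSystem n p) (g : GapSystem m a b) :
    (∃ w : Circle, (fun z => rotation w z) '' h.polygon.region ⊆ g.polygon.region) ↔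
      ∃ v : ℝ, ∀ j < n, ∃ i < m, ∃ k : ℤ, p j + v + k * Real.pi ∈ Set.Icc (a i) (b i) := by
  constructor
  · rintro ⟨w, hw⟩
    obtain ⟨v, hv⟩ := exists_cis_eq_circle w
    refine ⟨v, fun j hj => ?_⟩
    rw [← g.cis_mem_region_iff, cis_add, ← hv]
    exact hw ⟨_, h.cis_mem_region hj, rotation_apply _ _⟩
  · rintro ⟨v, hv⟩
    refine ⟨Circle.exp v, ?_⟩
    rintro _ ⟨z, hz, rfl⟩
    have hc : Convex ℝ ((fun z => rotation (Circle.exp v) z) ⁻¹' g.polygon.region) :=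
      g.polygon.convex_region.linear_preimage (rotation (Circle.exp v)).toLinearEquiv.toLinearMap
    refine convexHull_min ?_ hc hz
    intro z hz
    obtain ⟨k, hk, rfl⟩ := List.mem_map.1 hz
    rw [List.mem_range] at hk
    simp only [Set.mem_preimage, rotation_apply]
    rw [← cis_eq_exp, ← cis_add]
    by_cases hkn : k < n
    · exact (g.cis_mem_region_iff _).2 (hv k hkn)
    · rw [show k = k - n + n by omega, h.add, add_right_comm, cis_add_pi]
      exact g.neg_mem_region ((g.cis_mem_region_iff _).2 (hv (k - n) (by omega)))

/-- For centrally symmetric polygons a translation cannot help. -/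
theorem exists_rigidMotion_iff (h : AngleSystem n p) (g : GapSystem m a b) :
    (∃ (w : Circle) (t : ℂ),
      (fun z => rotation w z + t) '' h.polygon.region ⊆ g.polygon.region) ↔
      ∃ v : ℝ, ∀ j < n, ∃ i < m, ∃ k : ℤ, p j + v + k * Real.pi ∈ Set.Icc (a i) (b i) := by
  constructor
  · rintro ⟨w, t, hw⟩
    obtain ⟨v, hv⟩ := exists_cis_eq_circle w
    refine ⟨v, fun j hj => ?_⟩
    rw [← g.cis_mem_region_iff, cis_add, ← hv]
    have h1 := hw ⟨_, h.cis_mem_region hj, rfl⟩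
    -- The antipode `-z` of a vertex `z` is moved to `-w * z + t`; its reflection `w * z - t` lies
    -- in the symmetric polygon, and the midpoint with `w * z + t` is the purely rotated vertex.
    have h2 := g.neg_mem_region (hw ⟨_, h.neg_cis_mem_region hj, rfl⟩)
    have := g.polygon.convex_region h1 h2 (a := 1 / 2) (b := 1 / 2) (by norm_num) (by norm_num)
      (by norm_num)
    simp only [rotation_apply, Complex.real_smul] at this
    convert this using 1
    push_cast
    ring
  · intro hv
    obtain ⟨w, hw⟩ := (h.exists_rotation_iff g).2 hv
    exact ⟨w, 0, by simpa using hw⟩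

end AngleSystem

/-! ### Executions without oracle calls -/

namespace RealRAM

/-- From `s`, the program halts within `T` operations, without calling the oracle, in a
configuration with the property `Q`. -/
def Runs (B : Problem) (p : Prog) (s : State) (T : ℕ) (Q : State → Prop) : Prop :=
  ∃ s' t, Exec B p s s' t [] ∧ t ≤ T ∧ Q s'

section

variable {B : Problem}

theorem Runs.mono {p : Prog} {s : State} {T T' : ℕ} {Q Q' : State → Prop} (h : Runs B p s T Q)
    (hT : T ≤ T') (hQ : ∀ s', Q s' → Q' s') : Runs B p s T' Q' :=
  let ⟨s', t, he, ht, hq⟩ := h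
  ⟨s', t, he, ht.trans hT, hQ s' hq⟩

theorem Runs.seq {p₁ p₂ : Prog} {s : State} {T₁ T₂ : ℕ} {Q₁ Q : State → Prop}
    (h₁ : Runs B p₁ s T₁ Q₁) (h₂ : ∀ s', Q₁ s' → Runs B p₂ s' T₂ Q) :
    Runs B (.seq p₁ p₂) s (T₁ + T₂) Q := by
  obtain ⟨s', t, he, ht, hq⟩ := h₁
  obtain ⟨s'', t', he', ht', hq'⟩ := h₂ s' hq
  exact ⟨s'', t + t', he.seq he', add_le_add ht ht', hq'⟩

/-- A loop whose test holds at most `N` times. -/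
theorem Runs.loop {b : BExp} {p : Prog} {c N : ℕ} (Inv : ℕ → State → Prop)
    (step : ∀ i s, Inv i s → b.holds s → i < N ∧ Runs B p s c (Inv (i + 1))) {s : State}
    (h0 : Inv 0 s) :
    Runs B (.loop b p) s (N * (c + b.cost + 1) + b.cost + 1)
      (fun s' => ¬ b.holds s' ∧ ∃ i, Inv i s') := by
  -- Here `r` bounds the number of iterations still to come.
  suffices H : ∀ r i s, Inv i s → N ≤ i + r →
      Runs B (.loop b p) s (r * (c + b.cost + 1) + b.cost + 1)
        (fun s' => ¬ b.holds s' ∧ ∃ i, Inv i s') from H N 0 s h0 (by omega)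
  intro r
  induction r with
  | zero =>
    intro i s hi hN
    by_cases hb : b.holds s
    · have := (step i s hi hb).1
      omega
    · exact ⟨s, _, .loop_done hb, by omega, hb, i, hi⟩
  | succ r ih =>
    intro i s hi hN
    by_cases hb : b.holds s
    · obtain ⟨s', t, he, ht, hq⟩ := (step i s hi hb).2
      obtain ⟨s'', t', he', ht', hq'⟩ := ih (i + 1) s' hq (by omega)
      refine ⟨s'', _, .loop_step hb he he', ?_, hq'⟩
      rw [Nat.succ_mul]
      omega
    · exact ⟨s, _, .loop_done hb, by omega, hb, i, hi⟩

end

/-- The largest cost of an execution of a program without loops and oracle calls. -/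
def Prog.cost : Prog → ℕ
  | .skip => 1
  | .setI _ e => e.cost + 1
  | .setR _ e => e.cost + 1
  | .store _ e v => e.cost + v.cost + 1
  | .seq p₁ p₂ => p₁.cost + p₂.cost
  | .ite b p₁ p₂ => b.cost + max p₁.cost p₂.cost + 1
  | .loop _ _ => 0
  | .ask _ _ => 0

/-- The weakest precondition of a program without loops and oracle calls. -/
def Prog.wp : Prog → (State → Prop) → State → Prop
  | .skip, Q, s => Q s
  | .setI i e, Q, s => Q (s.setInt i (e.eval s))
  | .setR i e, Q, s => Q (s.setReal i (e.eval s))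
  | .store a e v, Q, s => Q (s.setCell a (e.eval s) (v.eval s))
  | .seq p₁ p₂, Q, s => p₁.wp (p₂.wp Q) s
  | .ite b p₁ p₂, Q, s => (b.holds s → p₁.wp Q s) ∧ (¬ b.holds s → p₂.wp Q s)
  | .loop _ _, _, _ => False
  | .ask _ _, _, _ => False

theorem Runs.of_wp {B : Problem} {p : Prog} {Q : State → Prop} {s : State} (h : p.wp Q s) :
    Runs B p s p.cost Q := by
  induction p generalizing Q s with
  | skip => exact ⟨_, _, .skip _, le_rfl, h⟩
  | setI i e => exact ⟨_, _, .setI _ _ _, le_rfl, h⟩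
  | setR i e => exact ⟨_, _, .setR _ _ _, le_rfl, h⟩
  | store a e v => exact ⟨_, _, .store _ _ _ _, le_rfl, h⟩
  | seq p₁ p₂ ih₁ ih₂ => exact (ih₁ h).seq fun s' hs' => ih₂ hs'
  | ite b p₁ p₂ ih₁ ih₂ =>
    by_cases hb : b.holds s
    · obtain ⟨s', t, he, ht, hq⟩ := ih₁ (h.1 hb)
      exact ⟨s', _, .ite_true hb he, by simp only [Prog.cost]; omega, hq⟩
    · obtain ⟨s', t, he, ht, hq⟩ := ih₂ (h.2 hb)
      exact ⟨s', _, .ite_false hb he, by simp only [Prog.cost]; omega, hq⟩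
  | loop b p => exact h.elim
  | ask as r => exact h.elim

/-! ### Effect of assignments on the memory -/

namespace State

variable (s : State) (i j a c n : ℕ) (x : ℝ)

theorem setInt_int : (s.setInt i n).int j = if j = i then n else s.int j := by
  simp [setInt, Function.update_apply]

theorem setInt_arr : (s.setInt i n).arr = s.arr := rfl

theorem setReal_int : (s.setReal i x).int = s.int := rfl

theorem setReal_real : (s.setReal i x).real j = if j = i then x else s.real j := by
  simp [setReal, Function.update_apply]

theorem setReal_arr : (s.setReal i x).arr = s.arr := rfl

theorem setCell_int : (s.setCell a j x).int = s.int := rfl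

theorem setCell_real : (s.setCell a j x).real = s.real := rfl

theorem setCell_arr : (s.setCell a j x).arr c =
    if c = a then Function.update (s.arr a) j x else s.arr c := by
  simp [setCell, Function.update_apply]

end State

/-! ### Merge sort -/

/-- Enter the next pair of blocks if the current one is exhausted. The registers hold the block
length (`10`), the positions in the two input blocks (`11`, `13`), their ends (`12`, `14`) and the
position in the output (`15`). -/
def openBlocks (a : ℕ) : Prog :=
  .ite (.ilt (.reg 15) (.reg 14)) .skip <|
    .seq (.setI 11 (.reg 14)) <|
    -- With truncated subtraction, `x - (x - n)` is the minimum of `x` and `n`; block ends are thus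
    -- cut off at the end of the array.
    .seq (.setI 12 (.sub (.add (.reg 11) (.reg 10))
      (.sub (.add (.reg 11) (.reg 10)) (.reg a)))) <|
    .seq (.setI 13 (.reg 12)) <|
    .setI 14 (.sub (.add (.add (.reg 11) (.reg 10)) (.reg 10))
      (.sub (.add (.add (.reg 11) (.reg 10)) (.reg 10)) (.reg a)))

/-- Move the smaller one of the first elements of the two input blocks to array `3`. -/
def moveLeast (a : ℕ) : Prog :=
  .seq (.ite (.and (.ilt (.reg 11) (.reg 12))
      (.not (.and (.ilt (.reg 13) (.reg 14)) (.rlt (.load a (.reg 13)) (.load a (.reg 11))))))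
    (.seq (.store 3 (.reg 15) (.load a (.reg 11))) (.setI 11 (.add (.reg 11) (.const 1))))
    (.seq (.store 3 (.reg 15) (.load a (.reg 13))) (.setI 13 (.add (.reg 13) (.const 1))))) <|
  .setI 15 (.add (.reg 15) (.const 1))

def mergeStep (a : ℕ) : Prog :=
  .seq (openBlocks a) (moveLeast a)

/-- Merge the blocks of length `int 10` of array `a` into blocks of twice this length of
array `3`. -/
def mergePass (a : ℕ) : Prog :=
  .seq (.seq (.setI 11 (.const 0)) <| .seq (.setI 12 (.const 0)) <|
    .seq (.setI 13 (.const 0)) <| .seq (.setI 14 (.const 0)) <| .setI 15 (.const 0)) <|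
  .loop (.ilt (.reg 15) (.reg a)) (mergeStep a)

def copyBack (a : ℕ) : Prog :=
  .seq (.setI 11 (.const 0)) <|
  .loop (.ilt (.reg 11) (.reg a))
    (.seq (.store a (.reg 11) (.load 3 (.reg 11))) (.setI 11 (.add (.reg 11) (.const 1))))

/-- Bottom-up merge sort: the block length doubles until one block covers the array, so no recursion
is needed. Array `3` is scratch space. -/
def mergeSort (a : ℕ) : Prog :=
  .seq (.setI 10 (.const 1)) <|
  .loop (.ilt (.reg 10) (.reg a))
    (.seq (mergePass a) <| .seq (copyBack a) <| .setI 10 (.add (.reg 10) (.reg 10)))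

/-- The values of `f` at the positions below `n`. -/
def values (f : ℕ → ℝ) (n : ℕ) : Multiset ℝ :=
  ∑ i ∈ Finset.range n, {f i}

/-- `f` is monotone on each block of length `w` of the positions below `n`. -/
def BlockSorted (w n : ℕ) (f : ℕ → ℝ) : Prop :=
  ∀ x y, x ≤ y → y < n → x / w = y / w → f x ≤ f y

/-- `s'` agrees with `s` outside the array `a` and the working memory of the sorting program. -/
structure SortFrame (a : ℕ) (s s' : State) : Prop where
  int : ∀ r < 10, s'.int r = s.int r
  real : s'.real = s.real
  arr : ∀ c, c ≠ a → c ≠ 3 → s'.arr c = s.arr c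

theorem SortFrame.trans {a : ℕ} {s₁ s₂ s₃ : State} (h₁ : SortFrame a s₁ s₂)
    (h₂ : SortFrame a s₂ s₃) : SortFrame a s₁ s₃ :=
  ⟨fun r hr => (h₂.int r hr).trans (h₁.int r hr), h₂.real.trans h₁.real,
    fun c hc hc' => (h₂.arr c hc hc').trans (h₁.arr c hc hc')⟩

/-- The state of a merge pass after `k` steps: `f` is the input, `t` the output. -/
structure MergeInv (w n : ℕ) (f t : ℕ → ℝ) (k i mid j hi : ℕ) : Prop where
  -- The current pair of blocks starts at `lo`; its first block ends at `mid`, its second at `hi`,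
  -- and the second is empty if the first is cut short. The last clause says that what this pair has
  -- put out is at most what it still holds, which keeps the output sorted.
  lo : ∃ lo, 2 * w ∣ lo ∧ lo ≤ i ∧ mid ≤ lo + w ∧ hi ≤ lo + 2 * w ∧ (mid = lo + w ∨ mid = hi) ∧
    ∀ x, lo ≤ x → x < k → (∀ y, i ≤ y → y < mid → t x ≤ f y) ∧ ∀ y, j ≤ y → y < hi → t x ≤ f y
  hi_dvd : 2 * w ∣ hi ∨ hi = n
  le_mid : i ≤ mid
  mid_le : mid ≤ j
  le_hi : j ≤ hi
  hi_le : hi ≤ n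
  eq : k + mid = i + j
  sorted : BlockSorted (2 * w) k t
  perm : values t k = values f i + ∑ x ∈ Finset.Ico mid j, {f x}

theorem values_succ (f : ℕ → ℝ) (n : ℕ) : values f (n + 1) = values f n + {f n} :=
  Finset.sum_range_succ _ _

theorem values_congr {f g : ℕ → ℝ} {n : ℕ} (h : ∀ i < n, f i = g i) : values f n = values g n :=
  Finset.sum_congr rfl fun i hi => by rw [h i (Finset.mem_range.1 hi)]

theorem values_update (f : ℕ → ℝ) (n : ℕ) (x : ℝ) :
    values (Function.update f n x) n = values f n :=
  values_congr fun i hi => by rw [Function.update_of_ne (by omega)]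

theorem div_eq_div_of_mem_block {d lo x y : ℕ} (hd : d ∣ lo) (hx : lo ≤ x) (hx' : x < lo + d)
    (hy : lo ≤ y) (hy' : y < lo + d) : x / d = y / d := by
  obtain ⟨c, rfl⟩ := hd
  have h : ∀ z, d * c ≤ z → z < d * c + d → z / d = c := fun z h1 h2 =>
    Nat.div_eq_of_lt_le (by rwa [mul_comm]) (by rw [Nat.succ_mul, mul_comm]; exact h2)
  rw [h x hx hx', h y hy hy']

theorem le_of_div_eq_div {d lo x y : ℕ} (hd : d ∣ lo) (hy : lo ≤ y) (h : x / d = y / d) :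
    lo ≤ x := by
  obtain ⟨c, rfl⟩ := hd
  rcases Nat.eq_zero_or_pos d with rfl | hd
  · simp
  · rw [mul_comm] at hy ⊢
    rwa [← Nat.le_div_iff_mul_le hd, h, Nat.le_div_iff_mul_le hd]

/-- Appending preserves sortedness if the new value dominates the earlier ones of its own block;
other blocks impose nothing. -/
theorem BlockSorted.update {w k : ℕ} {t : ℕ → ℝ} {v : ℝ} (h : BlockSorted w k t)
    (hv : ∀ x < k, x / w = k / w → t x ≤ v) : BlockSorted w (k + 1) (Function.update t k v) := by
  intro x y hxy hy he
  rcases Nat.lt_succ_iff_lt_or_eq.1 hy with hy | rfl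
  · rw [Function.update_of_ne (by omega), Function.update_of_ne (by omega)]
    exact h x y hxy hy he
  · rcases hxy.lt_or_eq with hx | rfl
    · rw [Function.update_of_ne (by omega), Function.update_self]
      exact hv x hx he
    · exact le_rfl

/-! ### Preservation of the merging invariant -/

namespace MergeInv

variable {w n : ℕ} {f t : ℕ → ℝ} {k i mid j hi : ℕ}

theorem init (w n : ℕ) (f t : ℕ → ℝ) : MergeInv w n f t 0 0 0 0 0 where
  lo := ⟨0, dvd_zero _, le_rfl, by omega, by omega, .inr rfl, fun x _ hx => by omega⟩
  hi_dvd := .inl (dvd_zero _)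
  le_mid := le_rfl
  mid_le := le_rfl
  le_hi := le_rfl
  hi_le := Nat.zero_le _
  eq := rfl
  sorted := fun x y _ hy => by omega
  perm := by simp [values]

/-- Once the output has reached `hi`, the position equation shows both blocks to be exhausted. As
`hi` is not the end of the array, it is a multiple of `2 * w` and can start the next pair. -/
theorem restart (h : MergeInv w n f t k i mid j hi) (hk : ¬ k < hi) (hkn : k < n) :
    MergeInv w n f t k hi (min (hi + w) n) (min (hi + w) n) (min (hi + w + w) n) := by
  have h1 := h.eq
  have h2 := h.le_mid
  have h3 := h.mid_le
  have h4 := h.le_hi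
  obtain rfl : k = hi := by omega
  obtain rfl : j = k := by omega
  obtain rfl : i = mid := by omega
  refine ⟨⟨j, ?_, le_rfl, by omega, by omega, by omega, fun x _ hx => by omega⟩, ?_, by omega,
    le_rfl, by omega, by omega, by omega, h.sorted, ?_⟩
  · exact h.hi_dvd.resolve_right (by omega)
  · rcases Nat.lt_or_ge (j + w + w) n with hlt | hge
    · left
      rw [min_eq_left hlt.le, show j + w + w = j + 2 * w by ring]
      exact (Nat.dvd_add_self_right).2 (h.hi_dvd.resolve_right (by omega))
    · exact .inr (min_eq_right hge)
  · rw [h.perm, Finset.Ico_self, Finset.sum_empty, add_zero]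
    simp only [values]
    exact Finset.sum_range_add_sum_Ico _ h3

/-- The moved element is at most the rest of its own block by sortedness, and at most the other
block because it is at most that block's first element. -/
theorem left (h : MergeInv w n f t k i mid j hi) (hf : BlockSorted w n f) (hi' : i < mid)
    (hle : j < hi → f i ≤ f j) :
    MergeInv w n f (Function.update t k (f i)) (k + 1) (i + 1) mid j hi := by
  obtain ⟨lo, hlo, hloi, hmid, hhi, hmid', hall⟩ := h.lo
  have h1 := h.eq
  have h2 := h.le_mid
  have h3 := h.mid_le
  have h4 := h.le_hi
  have h5 := h.hi_le
  have hwlo : w ∣ lo := (Dvd.intro_left 2 rfl).trans hlo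
  refine ⟨⟨lo, hlo, by omega, hmid, hhi, hmid', fun x hx hxk => ?_⟩, h.hi_dvd, by omega, h3, h4, h5,
    by omega, ?_, ?_⟩
  · rcases Nat.lt_succ_iff_lt_or_eq.1 hxk with hxk | rfl
    · rw [Function.update_of_ne (by omega)]
      exact ⟨fun y hy => (hall x hx hxk).1 y (by omega), (hall x hx hxk).2⟩
    · rw [Function.update_self]
      refine ⟨fun y hy hym => hf i y (by omega) (by omega) ?_, fun y hy hyh => ?_⟩
      · exact div_eq_div_of_mem_block hwlo (by omega) (by omega) (by omega) (by omega)
      · refine (hle (by omega)).trans (hf j y hy (by omega) ?_)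
        have : mid = lo + w := by omega
        exact div_eq_div_of_mem_block (lo := lo + w) (Nat.dvd_add_self_right.2 hwlo) (by omega)
          (by omega) (by omega) (by omega)
  · exact h.sorted.update fun x hx he =>
      (hall x (le_of_div_eq_div hlo (by omega) he) hx).1 i le_rfl hi'
  · rw [values_succ, values_update, Function.update_self, h.perm, values_succ, add_right_comm]

theorem right (h : MergeInv w n f t k i mid j hi) (hf : BlockSorted w n f) (hj : j < hi)
    (hle : i < mid → f j ≤ f i) :
    MergeInv w n f (Function.update t k (f j)) (k + 1) i mid (j + 1) hi := by
  obtain ⟨lo, hlo, hloi, hmid, hhi, hmid', hall⟩ := h.lo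
  have h1 := h.eq
  have h2 := h.le_mid
  have h3 := h.mid_le
  have h4 := h.le_hi
  have h5 := h.hi_le
  have hwlo : w ∣ lo := (Dvd.intro_left 2 rfl).trans hlo
  refine ⟨⟨lo, hlo, by omega, hmid, hhi, hmid', fun x hx hxk => ?_⟩, h.hi_dvd, h2, by omega,
    by omega, h5, by omega, ?_, ?_⟩
  · rcases Nat.lt_succ_iff_lt_or_eq.1 hxk with hxk | rfl
    · rw [Function.update_of_ne (by omega)]
      exact ⟨(hall x hx hxk).1, fun y hy => (hall x hx hxk).2 y (by omega)⟩
    · rw [Function.update_self]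
      refine ⟨fun y hy hym => ?_, fun y hy hyh => hf j y (by omega) (by omega) ?_⟩
      · refine (hle (by omega)).trans (hf i y hy (by omega) ?_)
        exact div_eq_div_of_mem_block hwlo (by omega) (by omega) (by omega) (by omega)
      · have : mid = lo + w := by omega
        exact div_eq_div_of_mem_block (lo := lo + w) (Nat.dvd_add_self_right.2 hwlo) (by omega)
          (by omega) (by omega) (by omega)
  · exact h.sorted.update fun x hx he =>
      (hall x (le_of_div_eq_div hlo (by omega) he) hx).2 j le_rfl hj
  · rw [values_succ, values_update, Function.update_self, h.perm, Finset.sum_Ico_succ_top h3,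
      add_assoc]

theorem final (h : MergeInv w n f t k i mid j hi) (hk : ¬ k < n) (hkn : k ≤ n) :
    BlockSorted (2 * w) n t ∧ values t n = values f n := by
  have h1 := h.eq
  have h2 := h.le_mid
  have h3 := h.mid_le
  have h4 := h.le_hi
  have h5 := h.hi_le
  obtain rfl : k = n := by omega
  obtain rfl : j = k := by omega
  obtain rfl : i = mid := by omega
  refine ⟨h.sorted, ?_⟩
  rw [h.perm]
  exact Finset.sum_range_add_sum_Ico _ h3

end MergeInv

/-! ### Correctness and running time of merge sort -/

section

variable {B : Problem} {a : ℕ}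

/-- The invariant of the loop of a merge pass started in `s`. -/
structure PassInv (a : ℕ) (s : State) (k : ℕ) (s' : State) : Prop where
  frame : SortFrame a s s'
  arr : s'.arr a = s.arr a
  width : s'.int 10 = s.int 10
  pos : s'.int 15 = k
  le : k ≤ s.int a
  merge : MergeInv (s.int 10) (s.int a) (s.arr a) (s'.arr 3) k (s'.int 11) (s'.int 12)
    (s'.int 13) (s'.int 14)

theorem runs_openBlocks (ha : a < 3) {s s' : State} (hw : 0 < s.int 10) {k : ℕ}
    (h : PassInv a s k s')
    (hk : k < s.int a) :
    Runs B (openBlocks a) s' (openBlocks a).cost fun s' => PassInv a s k s' ∧ k < s'.int 14 := by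
  have hne : ∀ r, 10 ≤ r → a ≠ r := by omega
  have hint : s'.int a = s.int a := h.frame.int a (by omega)
  refine Runs.of_wp ⟨fun hb => ⟨h, h.pos ▸ hb⟩, fun hb => ?_⟩
  have hkh : ¬ k < s'.int 14 := h.pos ▸ hb
  have hm := h.merge.restart hkh hk
  have h2 := h.merge.eq
  have h3 := h.merge.le_mid
  have h4 := h.merge.mid_le
  have h5 := h.merge.le_hi
  refine ⟨⟨⟨fun r hr => ?_, h.frame.real, h.frame.arr⟩, h.arr, ?_, ?_, h.le, ?_⟩, ?_⟩
  · simp only [State.setInt_int, show r ≠ 11 by omega, show r ≠ 12 by omega,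
      show r ≠ 13 by omega, show r ≠ 14 by omega, if_false]
    exact h.frame.int r hr
  · simp [State.setInt_int, h.width]
  · simp [State.setInt_int, h.pos]
  · simpa [State.setInt_int, State.setInt_arr, IExp.eval, hne, hint, h.width, tsub_tsub_eq_min]
      using hm
  · simp [State.setInt_int, IExp.eval, hne, hint, h.width, tsub_tsub_eq_min]
    omega

theorem runs_moveLeast (ha : a < 3) {s : State}
    (hf : BlockSorted (s.int 10) (s.int a) (s.arr a)) {k : ℕ} {s' : State}
    (h : PassInv a s k s') (hk : k < s.int a) (hk' : k < s'.int 14) :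
    Runs B (moveLeast a) s' (moveLeast a).cost (PassInv a s (k + 1)) := by
  have ha3 : a ≠ 3 := by omega
  have frame : ∀ (x : ℝ) (r : ℕ) (u v : ℕ), 10 ≤ r →
      SortFrame a s (((s'.setCell 3 u x).setInt r v).setInt 15 (u + 1)) := by
    intro x r u v hr
    refine ⟨fun q hq => ?_, h.frame.real, fun c hc hc' => ?_⟩
    · simp only [State.setInt_int, State.setCell_int, show q ≠ 15 by omega, show q ≠ r by omega,
        if_false]
      exact h.frame.int q hq
    · simp only [State.setInt_arr, State.setCell_arr, hc', if_false]
      exact h.frame.arr c hc hc'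
  have h2 := h.merge.eq
  have h3 := h.merge.le_mid
  have h4 := h.merge.mid_le
  have h5 := h.merge.le_hi
  refine Runs.of_wp ⟨fun hb => ?_, fun hb => ?_⟩
  · have hb' : s'.int 11 < s'.int 12 ∧
        ¬ (s'.int 13 < s'.int 14 ∧ s'.arr a (s'.int 13) < s'.arr a (s'.int 11)) := hb
    rw [h.arr, not_and, not_lt] at hb'
    have hm := h.merge.left hf hb'.1 hb'.2
    refine ⟨frame _ 11 _ _ (by omega), ?_, ?_, ?_, hk, ?_⟩
    · simp [State.setInt_arr, State.setCell_arr, ha3, h.arr]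
    · simp [State.setInt_int, State.setCell_int, h.width]
    · simp [State.setInt_int, State.setCell_int, IExp.eval, h.pos]
    · simpa [State.setInt_int, State.setInt_arr, State.setCell_int, State.setCell_arr, IExp.eval,
        RExp.eval, h.pos, h.arr] using hm
  · have hb' : ¬ (s'.int 11 < s'.int 12 ∧
        ¬ (s'.int 13 < s'.int 14 ∧ s'.arr a (s'.int 13) < s'.arr a (s'.int 11))) := hb
    rw [h.arr] at hb'
    -- If the first block is exhausted, the position equation identifies the output position with
    -- that in the second block, which is therefore not exhausted.
    have hj : s'.int 13 < s'.int 14 := by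
      by_contra hj
      by_cases hi : s'.int 11 < s'.int 12
      · exact hb' ⟨hi, fun h => hj h.1⟩
      · omega
    have hm := h.merge.right hf hj fun hi => by
      by_contra! hcon
      exact hb' ⟨hi, fun h => absurd h.2 (not_lt.2 hcon.le)⟩
    refine ⟨frame _ 13 _ _ (by omega), ?_, ?_, ?_, hk, ?_⟩
    · simp [State.setInt_arr, State.setCell_arr, ha3, h.arr]
    · simp [State.setInt_int, State.setCell_int, h.width]
    · simp [State.setInt_int, State.setCell_int, IExp.eval, h.pos]
    · simpa [State.setInt_int, State.setInt_arr, State.setCell_int, State.setCell_arr, IExp.eval,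
        RExp.eval, h.pos, h.arr] using hm

theorem runs_mergeStep (ha : a < 3) {s : State} (hw : 0 < s.int 10)
    (hf : BlockSorted (s.int 10) (s.int a) (s.arr a)) {k : ℕ} {s' : State}
    (h : PassInv a s k s') (hk : k < s.int a) :
    Runs B (mergeStep a) s' (mergeStep a).cost (PassInv a s (k + 1)) :=
  (runs_openBlocks ha hw h hk).seq fun _ hs => runs_moveLeast ha hf hs.1 hk hs.2

theorem runs_mergePass (ha : a < 3) (s : State) (hw : 0 < s.int 10)
    (hf : BlockSorted (s.int 10) (s.int a) (s.arr a)) :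
    Runs B (mergePass a) s (100 * s.int a + 20) fun s' => SortFrame a s s' ∧
      s'.arr a = s.arr a ∧ s'.int 10 = s.int 10 ∧
      BlockSorted (2 * s.int 10) (s.int a) (s'.arr 3) ∧
      values (s'.arr 3) (s.int a) = values (s.arr a) (s.int a) := by
  refine Runs.mono (Runs.seq (Q₁ := PassInv a s 0) (Runs.of_wp ?_) fun s' hs' =>
    Runs.loop (N := s.int a) (c := (mergeStep a).cost) (PassInv a s) (fun k s' hs' hb => ?_) hs')
    ?_ ?_
  · refine ⟨⟨fun r hr => ?_, rfl, fun c _ _ => rfl⟩, rfl, rfl, rfl, Nat.zero_le _, .init _ _ _ _⟩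
    simp only [State.setInt_int]
    split_ifs <;> omega
  · have hk : k < s.int a := by
      have : s'.int 15 < s'.int a := hb
      rwa [hs'.pos, hs'.frame.int a (by omega)] at this
    exact ⟨hk, runs_mergeStep ha hw hf hs' hk⟩
  · have : (mergeStep a).cost + (BExp.ilt (.reg 15) (.reg a)).cost + 1 ≤ 100 := by
      simp [mergeStep, openBlocks, moveLeast, Prog.cost, BExp.cost, IExp.cost, RExp.cost]
    have := Nat.mul_le_mul_left (s.int a) this
    simp [Prog.cost, BExp.cost, IExp.cost] at this ⊢
    omega
  · rintro s' ⟨hb, k, h⟩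
    have hk : ¬ k < s.int a := by
      have : ¬ s'.int 15 < s'.int a := hb
      rwa [h.pos, h.frame.int a (by omega)] at this
    exact ⟨h.frame, h.arr, h.width, h.merge.final hk h.le⟩

/-- The invariant of the copying loop started in `s`. -/
structure CopyInv (a : ℕ) (s : State) (k : ℕ) (s' : State) : Prop where
  frame : SortFrame a s s'
  tmp : s'.arr 3 = s.arr 3
  width : s'.int 10 = s.int 10
  pos : s'.int 11 = k
  eq : ∀ i < k, s'.arr a i = s.arr 3 i

theorem runs_copyBack (ha : a < 3) (s : State) :
    Runs B (copyBack a) s (20 * s.int a + 10) fun s' => SortFrame a s s' ∧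
      s'.int 10 = s.int 10 ∧ ∀ i < s.int a, s'.arr a i = s.arr 3 i := by
  refine Runs.mono (Runs.seq (Q₁ := CopyInv a s 0) (Runs.of_wp ?_) fun s' hs' =>
    Runs.loop (N := s.int a) (c := Prog.cost (.seq (.store a (.reg 11) (.load 3 (.reg 11)))
      (.setI 11 (.add (.reg 11) (.const 1))))) (CopyInv a s) (fun k s' hs' hb => ?_) hs') ?_ ?_
  · refine ⟨⟨fun r hr => ?_, rfl, fun c _ _ => rfl⟩, rfl, rfl, rfl, fun i hi => by omega⟩
    simp only [State.setInt_int]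
    split_ifs <;> omega
  · have hk : k < s.int a := by
      have : s'.int 11 < s'.int a := hb
      rwa [hs'.pos, hs'.frame.int a (by omega)] at this
    refine ⟨hk, Runs.of_wp ⟨⟨fun r hr => ?_, hs'.frame.real, fun c hc hc' => ?_⟩, ?_, ?_, ?_, ?_⟩⟩
    · simp only [State.setInt_int, State.setCell_int, show r ≠ 11 by omega, if_false]
      exact hs'.frame.int r hr
    · simp only [State.setInt_arr, State.setCell_arr, hc, if_false]
      exact hs'.frame.arr c hc hc'
    · simp [State.setInt_arr, State.setCell_arr, show 3 ≠ a by omega, hs'.tmp]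
    · simp [State.setInt_int, State.setCell_int, hs'.width]
    · simp [State.setInt_int, State.setCell_int, IExp.eval, hs'.pos]
    · intro i hi
      simp only [State.setInt_arr, State.setCell_arr, if_true, IExp.eval, RExp.eval, hs'.pos,
        hs'.tmp]
      rcases Nat.lt_succ_iff_lt_or_eq.1 hi with hi | rfl
      · rw [Function.update_of_ne (by omega), hs'.eq i hi]
      · rw [Function.update_self]
  · simp [Prog.cost, BExp.cost, IExp.cost, RExp.cost]
    omega
  · rintro s' ⟨hb, k, h⟩
    have hk : ¬ k < s.int a := by
      have : ¬ s'.int 11 < s'.int a := hb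
      rwa [h.pos, h.frame.int a (by omega)] at this
    exact ⟨h.frame, h.width, fun i hi => h.eq i (by omega)⟩

/-- The invariant of the main loop of the sorting program started in `s`. -/
structure MergeSortInv (a : ℕ) (s : State) (q : ℕ) (s' : State) : Prop where
  frame : SortFrame a s s'
  width : s'.int 10 = 2 ^ q
  sorted : BlockSorted (2 ^ q) (s.int a) (s'.arr a)
  perm : values (s'.arr a) (s.int a) = values (s.arr a) (s.int a)

theorem runs_mergeSort (ha : a < 3) (s : State) :
    Runs B (mergeSort a) s (200 * (s.int a + 1) * (Nat.clog 2 (s.int a) + 1)) fun s' =>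
      SortFrame a s s' ∧ (∀ x y, x ≤ y → y < s.int a → s'.arr a x ≤ s'.arr a y) ∧
      values (s'.arr a) (s.int a) = values (s.arr a) (s.int a) := by
  refine Runs.mono (Runs.seq (Q₁ := MergeSortInv a s 0) (Runs.of_wp ?_) fun s' hs' =>
    Runs.loop (N := Nat.clog 2 (s.int a))
      (c := (100 * s.int a + 20) + ((20 * s.int a + 10) +
        Prog.cost (.setI 10 (.add (.reg 10) (.reg 10)))))
      (MergeSortInv a s) (fun q s₁ h₁ hb => ?_) hs') ?_ ?_
  · refine ⟨⟨fun r hr => ?_, rfl, fun c _ _ => rfl⟩, rfl, fun x y hxy hy he => ?_, rfl⟩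
    · simp only [State.setInt_int]
      split_ifs <;> omega
    · rw [pow_zero, Nat.div_one, Nat.div_one] at he
      rw [he]
  · have hint : s₁.int a = s.int a := h₁.frame.int a (by omega)
    have hq : 2 ^ q < s.int a := by
      have : s₁.int 10 < s₁.int a := hb
      rwa [h₁.width, hint] at this
    -- Passes occur only while `2 ^ q` is below the length, so their number is at most its binary
    -- logarithm, rounded up.
    refine ⟨(Nat.lt_clog_iff_pow_lt (by norm_num)).2 hq, ?_⟩
    have hp := runs_mergePass (B := B) ha s₁ (by rw [h₁.width]; positivity)
      (by rw [h₁.width, hint]; exact h₁.sorted)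
    rw [hint] at hp
    refine hp.seq fun s₂ ⟨hf₂, _, hw₂, hs₂, hv₂⟩ => ?_
    have hc := runs_copyBack (B := B) ha s₂
    rw [hf₂.int a (by omega), hint] at hc
    refine hc.seq fun s₃ ⟨hf₃, hw₃, he₃⟩ => Runs.of_wp ?_
    have hw : s₃.int 10 = 2 ^ q := by rw [hw₃, hw₂, h₁.width]
    refine ⟨(h₁.frame.trans (hf₂.trans hf₃)).trans ⟨fun r hr => ?_, rfl, fun c _ _ => rfl⟩, ?_,
      fun x y hxy hy he => ?_, ?_⟩
    · simp only [State.setInt_int]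
      split_ifs <;> omega
    · simp only [State.setInt_int, IExp.eval, if_true, hw]
      ring
    · rw [State.setInt_arr, he₃ x (by omega), he₃ y hy]
      rw [h₁.width] at hs₂
      exact hs₂ x y hxy hy (by rwa [← pow_succ'])
    · rw [State.setInt_arr, values_congr he₃, hv₂, h₁.perm]
  · simp only [Prog.cost, BExp.cost, IExp.cost]
    nlinarith [Nat.zero_le (Nat.clog 2 (s.int a)), Nat.zero_le (s.int a)]
  · rintro s' ⟨hb, q, h⟩
    have hq : ¬ 2 ^ q < s.int a := by
      have : ¬ s'.int 10 < s'.int a := hb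
      rwa [h.width, h.frame.int a (by omega)] at this
    refine ⟨h.frame, fun x y hxy hy => h.sorted x y hxy hy ?_, h.perm⟩
    -- All positions now belong to block `0`.
    rw [Nat.div_eq_of_lt (by omega), Nat.div_eq_of_lt (by omega)]

end

end RealRAM

/-! ### From the line to the circle -/

/-- The sequence that begins with `f 0, …, f (m - 1)` and satisfies `u (i + m) = u i + π`. -/
noncomputable def periodize (m : ℕ) (f : ℕ → ℝ) (i : ℕ) : ℝ :=
  f (i % m) + (i / m : ℕ) * Real.pi

theorem periodize_add {m : ℕ} (hm : 0 < m) (f : ℕ → ℝ) (i : ℕ) :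
    periodize m f (i + m) = periodize m f i + Real.pi := by
  simp only [periodize, Nat.add_mod_right, Nat.add_div_right _ hm, Nat.cast_succ]
  ring

theorem periodize_of_lt {m i : ℕ} (f : ℕ → ℝ) (hi : i < m) : periodize m f i = f i := by
  simp [periodize, Nat.mod_eq_of_lt hi, Nat.div_eq_of_lt hi]

/-- Only the step from `m - 1` to `m` needs the bound by `π`; later indices reduce to earlier ones
by periodicity. -/
theorem periodize_lt_succ {m : ℕ} (hm : 0 < m) {f g : ℕ → ℝ}
    (h : ∀ i, i + 1 < m → g i < f (i + 1)) (h' : g (m - 1) < f 0 + Real.pi) (i : ℕ) :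
    periodize m g i < periodize m f (i + 1) := by
  induction i using Nat.strong_induction_on with
  | _ i ih =>
    rcases Nat.lt_or_ge i m with hi | hi
    · rw [periodize_of_lt g hi]
      rcases Nat.lt_or_ge (i + 1) m with hi' | hi'
      · rw [periodize_of_lt f hi']
        exact h i hi'
      · obtain rfl : m = i + 1 := by omega
        have := periodize_add hm f 0
        rw [zero_add, periodize_of_lt f hm] at this
        rw [this]
        exact h'
    · rw [show i = i - m + m by omega, add_right_comm, periodize_add hm, periodize_add hm]
      have := ih (i - m) (by omega)
      linarith

theorem GapSystem.periodize {m : ℕ} (hm : 2 ≤ m) {f g : ℕ → ℝ} (hle : ∀ i < m, f i ≤ g i)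
    (h : ∀ i, i + 1 < m → g i < f (i + 1)) (h' : g (m - 1) < f 0 + Real.pi) :
    GapSystem m (periodize m f) (periodize m g) where
  two_le := hm
  le i := add_le_add_left (hle _ (Nat.mod_lt _ (by omega))) _
  lt := periodize_lt_succ (by omega) h h'
  left_add := periodize_add (by omega) f
  right_add := periodize_add (by omega) g

theorem AngleSystem.periodize {n : ℕ} (hn : 2 ≤ n) {f : ℕ → ℝ}
    (h : ∀ i, i + 1 < n → f i < f (i + 1)) (h' : f (n - 1) < f 0 + Real.pi) :
    AngleSystem n (periodize n f) where
  two_le := hn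
  lt := periodize_lt_succ (by omega) h h'
  add := periodize_add (by omega) f

/-- Sorted data of an instance of `SegContPnt`. -/
structure SortedSegs (n m : ℕ) (p a b : ℕ → ℝ) : Prop where
  lt_pts : ∀ i j, i < j → j < n → p i < p j
  le : ∀ i < m, a i ≤ b i
  lt : ∀ i j, i < j → j < m → b i < a j

/-- Some translation moves all points into the union of the intervals. -/
def ContainsTranslate (n m : ℕ) (p a b : ℕ → ℝ) : Prop :=
  ∃ v : ℝ, ∀ j < n, ∃ i < m, p j + v ∈ Set.Icc (a i) (b i)

/-- The factor by which all data are divided to fit on the circle. -/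
def circleScale (n m : ℕ) (p a b : ℕ → ℝ) : ℝ :=
  -- The summand `1` keeps the divisor positive when both spreads vanish.
  p (n - 1) - p 0 + (b (m - 1) - a 0) + 1

namespace SortedSegs

variable {n m : ℕ} {p a b : ℕ → ℝ}

theorem le_pts (h : SortedSegs n m p a b) {i j : ℕ} (hij : i ≤ j) (hj : j < n) : p i ≤ p j := by
  rcases hij.eq_or_lt with rfl | hij
  · exact le_rfl
  · exact (h.lt_pts i j hij hj).le

theorem le_left (h : SortedSegs n m p a b) {i : ℕ} (hi : i < m) : a 0 ≤ a i := by
  rcases Nat.eq_zero_or_pos i with rfl | hi0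
  · exact le_rfl
  · exact (h.le 0 (by omega)).trans (h.lt 0 i hi0 hi).le

theorem right_le (h : SortedSegs n m p a b) {i : ℕ} (hi : i < m) : b i ≤ b (m - 1) := by
  rcases (Nat.le_sub_one_of_lt hi).eq_or_lt with rfl | hi'
  · exact le_rfl
  · exact (h.lt i (m - 1) hi' (by omega)).le.trans (h.le _ (by omega))

theorem one_le_circleScale (h : SortedSegs n m p a b) (hn : 0 < n) (hm : 0 < m) :
    1 ≤ circleScale n m p a b := by
  have h1 := h.le_pts (Nat.zero_le (n - 1)) (by omega)
  have h2 := h.le_left (i := m - 1) (by omega)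
  have h3 := h.le (m - 1) (by omega)
  rw [circleScale]
  linarith

theorem scale (h : SortedSegs n m p a b) {K : ℝ} (hK : 0 < K) :
    SortedSegs n m (fun i => p i / K) (fun i => a i / K) (fun i => b i / K) where
  lt_pts i j hij hj := div_lt_div_of_pos_right (h.lt_pts i j hij hj) hK
  le i hi := div_le_div_of_nonneg_right (h.le i hi) hK.le
  lt i j hij hj := div_lt_div_of_pos_right (h.lt i j hij hj) hK

theorem gapSystem (h : SortedSegs n m p a b) (hm : 2 ≤ m) (hlt : b (m - 1) - a 0 < Real.pi) :
    GapSystem m (periodize m a) (periodize m b) :=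
  .periodize hm h.le (fun i hi => h.lt i (i + 1) (Nat.lt_succ_self i) hi) (by linarith)

theorem angleSystem (h : SortedSegs n m p a b) (hn : 2 ≤ n) (hlt : p (n - 1) - p 0 < Real.pi) :
    AngleSystem n (periodize n p) :=
  .periodize hn (fun i hi => h.lt_pts i (i + 1) (Nat.lt_succ_self i) hi) (by linarith)

/-- If all data fit on a half circle, then translations modulo `π` are translations. -/
theorem exists_translate_mod_pi_iff (h : SortedSegs n m p a b)
    (hlt : p (n - 1) - p 0 + (b (m - 1) - a 0) < Real.pi) :
    (∃ v : ℝ, ∀ j < n, ∃ i < m, ∃ k : ℤ, periodize n p j + v + k * Real.pi ∈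
      Set.Icc (periodize m a i) (periodize m b i)) ↔ ContainsTranslate n m p a b := by
  constructor
  · rintro ⟨v, hv⟩
    rcases Nat.eq_zero_or_pos n with rfl | hn
    · exact ⟨0, fun j hj => by omega⟩
    obtain ⟨i₀, hi₀, k₀, h₀⟩ := hv 0 hn
    rw [periodize_of_lt _ hn, periodize_of_lt _ hi₀, periodize_of_lt _ hi₀] at h₀
    refine ⟨v + k₀ * Real.pi, fun j hj => ?_⟩
    obtain ⟨i, hi, k, hk⟩ := hv j hj
    rw [periodize_of_lt _ hj, periodize_of_lt _ hi, periodize_of_lt _ hi] at hk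
    refine ⟨i, hi, ?_⟩
    have e1 := h.le_pts (Nat.zero_le j) hj
    have e2 := h.le_pts (show j ≤ n - 1 by omega) (by omega)
    have e3 := h.le_left hi₀
    have e4 := h.right_le hi₀
    have e5 := h.le_left hi
    have e6 := h.right_le hi
    obtain ⟨f1, f2⟩ := h₀
    obtain ⟨g1, g2⟩ := hk
    have hpi := Real.pi_pos
    -- The two memberships force `(k - k₀) * π` to be at most the sum of the two spreads in absolute
    -- value, hence less than `π`.
    have hkk : k = k₀ := by
      by_contra hne
      rcases lt_or_gt_of_ne hne with hlt' | hlt'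
      · have : (k : ℝ) + 1 ≤ k₀ := by exact_mod_cast hlt'
        nlinarith
      · have : (k₀ : ℝ) + 1 ≤ k := by exact_mod_cast hlt'
        nlinarith
    rw [← hkk]
    constructor <;> linarith
  · rintro ⟨v, hv⟩
    refine ⟨v, fun j hj => ?_⟩
    obtain ⟨i, hi, hk⟩ := hv j hj
    refine ⟨i, hi, 0, ?_⟩
    rw [periodize_of_lt _ hj, periodize_of_lt _ hi, periodize_of_lt _ hi]
    simpa using hk

theorem containsTranslate_scale {K : ℝ} (hK : 0 < K) :
    ContainsTranslate n m (fun i => p i / K) (fun i => a i / K) (fun i => b i / K) ↔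
      ContainsTranslate n m p a b := by
  constructor
  · rintro ⟨v, hv⟩
    refine ⟨v * K, fun j hj => ?_⟩
    obtain ⟨i, hi, h1, h2⟩ := hv j hj
    refine ⟨i, hi, ?_, ?_⟩
    · have := mul_le_mul_of_nonneg_right h1 hK.le
      rwa [add_mul, div_mul_cancel₀ _ hK.ne', div_mul_cancel₀ _ hK.ne'] at this
    · have := mul_le_mul_of_nonneg_right h2 hK.le
      rwa [add_mul, div_mul_cancel₀ _ hK.ne', div_mul_cancel₀ _ hK.ne'] at this
  · rintro ⟨v, hv⟩
    refine ⟨v / K, fun j hj => ?_⟩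
    obtain ⟨i, hi, h1, h2⟩ := hv j hj
    refine ⟨i, hi, ?_, ?_⟩
    · rw [← add_div]; exact div_le_div_of_nonneg_right h1 hK.le
    · rw [← add_div]; exact div_le_div_of_nonneg_right h2 hK.le

/-- These are the cases in which one of the polygons is not available. One point always fits, and
then the spread `0` passes the test; with one interval only the spread matters. -/
theorem containsTranslate_of_small (h : SortedSegs n m p a b) (hn : 0 < n) (hm : 0 < m)
    (hsmall : n < 2 ∨ m < 2) :
    ContainsTranslate n m p a b ↔ p (n - 1) - p 0 ≤ b 0 - a 0 := by
  constructor
  · rintro ⟨v, hv⟩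
    rcases hsmall with hn' | hm'
    · obtain rfl : n = 1 := by omega
      have := h.le 0 hm
      simpa using this
    · obtain ⟨i, hi, h1⟩ := hv 0 hn
      obtain ⟨j, hj, h2⟩ := hv (n - 1) (by omega)
      obtain rfl : i = 0 := by omega
      obtain rfl : j = 0 := by omega
      linarith [h1.1, h2.2]
  · intro hle
    refine ⟨a 0 - p 0, fun j hj => ⟨0, hm, ?_, ?_⟩⟩
    · linarith [h.le_pts (Nat.zero_le j) hj]
    · linarith [h.le_pts (show j ≤ n - 1 by omega) (by omega)]

end SortedSegs

/-! ### Sorting the data -/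

theorem values_eq_coe (f : ℕ → ℝ) (n : ℕ) :
    RealRAM.values f n = ((List.range n).map f : Multiset ℝ) := by
  induction n with
  | zero => rfl
  | succ n ih =>
    rw [RealRAM.values_succ, ih, List.range_succ, List.map_append, ← Multiset.coe_add]
    rfl

theorem values_getD (l : List ℝ) :
    RealRAM.values (fun j => l.getD j 0) l.length = (l : Multiset ℝ) := by
  rw [values_eq_coe]
  congr 1
  apply List.ext_getElem <;> simp +contextual

/-- A sorted rearrangement is determined by the values. -/
theorem map_range_eq_of_perm {f : ℕ → ℝ} {n : ℕ} (hf : ∀ x y, x ≤ y → y < n → f x ≤ f y)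
    {l : List ℝ} (hl : l.Pairwise (· ≤ ·)) (h : RealRAM.values f n = (l : Multiset ℝ)) :
    (List.range n).map f = l := by
  rw [values_eq_coe, Multiset.coe_eq_coe] at h
  refine h.eq_of_pairwise' ?_ hl
  rw [List.pairwise_map, List.pairwise_iff_getElem]
  intro i j hi hj hij
  simp only [List.length_range] at hi hj
  simpa using hf i j hij.le hj

/-- The program sorts left and right end points separately and forgets the pairing. Disjointness
restores it: the list of intervals ordered by left ends is also ordered by right ends, so both
sorted arrays are its projections. -/
theorem SegContPntInst.sorted {c : ℕ} (I : SegContPntInst c) {p a b : ℕ → ℝ}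
    (hp : ∀ x y, x ≤ y → y < I.pts.length → p x ≤ p y)
    (ha : ∀ x y, x ≤ y → y < I.segs.length → a x ≤ a y)
    (hb : ∀ x y, x ≤ y → y < I.segs.length → b x ≤ b y)
    (hp' : RealRAM.values p I.pts.length = (I.pts : Multiset ℝ))
    (ha' : RealRAM.values a I.segs.length = (I.segs.map Prod.fst : List ℝ))
    (hb' : RealRAM.values b I.segs.length = (I.segs.map Prod.snd : List ℝ)) :
    SortedSegs I.pts.length I.segs.length p a b ∧
      ((SegContPnt c).yes I ↔ ContainsTranslate I.pts.length I.segs.length p a b) := by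
  obtain ⟨L, hL, hLs⟩ : ∃ L : List (ℝ × ℝ), L.Perm I.segs ∧ L.Pairwise fun q q' => q.1 ≤ q'.1 := by
    classical
    exact ⟨I.segs.insertionSort (Prod.fst ⁻¹'o (· ≤ ·)), List.perm_insertionSort _ _,
      List.pairwise_insertionSort _ _⟩
  have hLle : ∀ q ∈ L, q.1 ≤ q.2 := fun q hq => I.segs_le q (hL.mem_iff.1 hq)
  have hLlt : L.Pairwise fun q q' => q.2 < q'.1 := by
    have hd := (hL.pairwise_iff (R := fun q q' : ℝ × ℝ =>
      Disjoint (Set.Icc q.1 q.2) (Set.Icc q'.1 q'.2)) (fun h => Disjoint.symm h)).2 I.segs_disjoint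
    refine (hLs.and hd).imp_of_mem ?_
    rintro q q' hq hq' ⟨h1, h2⟩
    -- Otherwise the left end of `q'` would belong to both intervals.
    by_contra! hcon
    exact Set.disjoint_left.1 h2 ⟨h1, hcon⟩ ⟨le_rfl, hLle q' hq'⟩
  have hfst : (List.range I.segs.length).map a = L.map Prod.fst := by
    refine map_range_eq_of_perm ha (List.pairwise_map.2 hLs) ?_
    rw [ha', Multiset.coe_eq_coe]
    exact (hL.map _).symm
  have hsnd : (List.range I.segs.length).map b = L.map Prod.snd := by
    refine map_range_eq_of_perm hb (List.pairwise_map.2 ?_) ?_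
    · exact hLlt.imp_of_mem fun {q q'} hq hq' h => h.le.trans (hLle _ hq')
    · rw [hb', Multiset.coe_eq_coe]
      exact (hL.map _).symm
  have hlen : L.length = I.segs.length := hL.length_eq
  have hfst' : ∀ i (hi : i < L.length), a i = L[i].1 := by
    intro i hi
    have := List.getElem_of_eq hfst (i := i) (by simpa using hlen ▸ hi)
    simpa using this
  have hsnd' : ∀ i (hi : i < L.length), b i = L[i].2 := by
    intro i hi
    have := List.getElem_of_eq hsnd (i := i) (by simpa using hlen ▸ hi)
    simpa using this
  have hperm : ((List.range I.pts.length).map p).Perm I.pts := by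
    rwa [values_eq_coe, Multiset.coe_eq_coe] at hp'
  refine ⟨⟨fun i j hij hj => (hp i j hij.le hj).lt_of_ne fun he => ?_, fun i hi => ?_,
    fun i j hij hj => ?_⟩, ?_⟩
  · have hnd := hperm.nodup_iff.2 I.pts_nodup
    exact hij.ne (List.inj_on_of_nodup_map hnd (List.mem_range.2 (hij.trans hj))
      (List.mem_range.2 hj) he)
  · rw [hfst' i (by omega), hsnd' i (by omega)]
    exact hLle _ (List.getElem_mem _)
  · rw [hfst' j (by omega), hsnd' i (by omega)]
    exact List.pairwise_iff_getElem.1 hLlt i j _ _ hij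
  · refine exists_congr fun v => ?_
    rw [Set.image_subset_iff]
    constructor
    · intro h j hj
      have := h (show p j ∈ {x | x ∈ I.pts} from
        hperm.mem_iff.1 (List.mem_map.2 ⟨j, List.mem_range.2 hj, rfl⟩))
      simp only [Set.mem_preimage, Set.mem_iUnion] at this
      obtain ⟨q, hq, hv⟩ := this
      obtain ⟨i, hi, rfl⟩ := List.mem_iff_getElem.1 (hL.mem_iff.2 hq)
      exact ⟨i, by omega, by rwa [hfst' i hi, hsnd' i hi]⟩
    · intro h x hx
      obtain ⟨j, hj, rfl⟩ := List.mem_map.1 (hperm.mem_iff.2 hx)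
      obtain ⟨i, hi, hv⟩ := h j (List.mem_range.1 hj)
      simp only [Set.mem_preimage, Set.mem_iUnion]
      refine ⟨L[i]'(by omega), hL.mem_iff.1 (List.getElem_mem _), ?_⟩
      rwa [hfst' i (by omega), hsnd' i (by omega)] at hv

namespace RealRAM

/-! ### Writing down the polygons -/

/-- Store the points of the unit circle with arguments `arr src j / real 1`, followed by their
antipodes, as the arrays `c` (abscissae) and `c + 1` (ordinates). -/
def circleStep (src c : ℕ) : Prog :=
  .seq (.setR 2 (.div (.load src (.reg 10)) (.reg 1))) <|
  .seq (.store c (.reg 10) (.cos (.reg 2))) <|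
  .seq (.store (c + 1) (.reg 10) (.sin (.reg 2))) <|
  .seq (.store c (.add (.reg 10) (.reg src)) (.sub (.const 0) (.cos (.reg 2)))) <|
  .seq (.store (c + 1) (.add (.reg 10) (.reg src)) (.sub (.const 0) (.sin (.reg 2)))) <|
  .setI 10 (.add (.reg 10) (.const 1))

def circlePoints (src c : ℕ) : Prog :=
  .seq (.setI 10 (.const 0)) <| .loop (.ilt (.reg 10) (.reg src)) (circleStep src c)

/-- A component of the difference of the circle points in the arrays `a` and `b`. -/
def diff (a b : ℕ) (e e' : IExp) : RExp :=
  .sub (.load a e) (.load b e')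

/-- Store the vertex `gapVertex i`, where `i` is in register `10`, and its antipode in the arrays
`6` and `7`. The end points of the arcs are in the arrays `8`, `9` and `10`, `11`. -/
def vertexStep : Prog :=
  .seq (.setI 11 (.add (.reg 10) (.const 1))) <|
  .seq (.setI 12 (.add (.reg 10) (.const 2))) <|
  .seq (.setR 2 (.div
    (.sub (.mul (diff 10 8 (.reg 11) (.reg 11)) (diff 9 11 (.reg 12) (.reg 11)))
      (.mul (diff 11 9 (.reg 11) (.reg 11)) (diff 8 10 (.reg 12) (.reg 11))))
    (.sub (.mul (diff 8 10 (.reg 11) (.reg 10)) (diff 9 11 (.reg 12) (.reg 11)))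
      (.mul (diff 9 11 (.reg 11) (.reg 10)) (diff 8 10 (.reg 12) (.reg 11)))))) <|
  .seq (.setR 3 (.add (.load 8 (.reg 11)) (.mul (.reg 2) (diff 8 10 (.reg 11) (.reg 10))))) <|
  .seq (.setR 4 (.add (.load 9 (.reg 11)) (.mul (.reg 2) (diff 9 11 (.reg 11) (.reg 10))))) <|
  .seq (.store 6 (.reg 10) (.reg 3)) <|
  .seq (.store 7 (.reg 10) (.reg 4)) <|
  .seq (.store 6 (.add (.reg 10) (.reg 1)) (.sub (.const 0) (.reg 3))) <|
  .seq (.store 7 (.add (.reg 10) (.reg 1)) (.sub (.const 0) (.reg 4))) <|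
  .setI 10 (.add (.reg 10) (.const 1))

def vertices : Prog :=
  .seq (.setI 10 (.const 0)) <| .loop (.ilt (.reg 10) (.reg 1)) vertexStep

/-- Write down the two polygons and their lengths. -/
def writePolygons : Prog :=
  .seq (.setR 1 (.add (.add (.reg 0) (.sub (.load 2 (.sub (.reg 1) (.const 1)))
    (.load 1 (.const 0)))) (.const 1))) <|
  .seq (circlePoints 0 4) <| .seq (circlePoints 1 8) <| .seq (circlePoints 2 10) <|
  .seq vertices <|
  .seq (.setI 4 (.add (.reg 0) (.reg 0))) <| .seq (.setI 5 (.add (.reg 0) (.reg 0))) <|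
  .seq (.setI 6 (.add (.reg 1) (.reg 1))) <| .setI 7 (.add (.reg 1) (.reg 1))

/-- Sort the data and compute the spread of the points in real register `0`. -/
def sortData : Prog :=
  .seq (mergeSort 0) <| .seq (mergeSort 1) <| .seq (mergeSort 2) <|
  .setR 0 (.sub (.load 0 (.sub (.reg 0) (.const 1))) (.load 0 (.const 0)))

/-- Answer instances with a single point or a single interval. -/
def decideSmall : Prog :=
  .ite (.rlt (.sub (.load 2 (.const 0)) (.load 1 (.const 0))) (.reg 0))
    (.setI 0 (.const 0)) (.setI 0 (.const 1))

/-- The program that solves `SegContPnt` by one question about convex polygons. -/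
def reduction : Prog :=
  -- Without points the answer is yes; with points but no intervals it is no.
  .ite (.ilt (.reg 0) (.const 1)) (.setI 0 (.const 1)) <|
  .ite (.ilt (.reg 1) (.const 1)) (.setI 0 (.const 0)) <|
  .seq sortData <|
  .ite (.and (.ilt (.const 1) (.reg 0)) (.ilt (.const 1) (.reg 1)))
    (.seq writePolygons (.ask [4, 5, 6, 7] 0)) decideSmall

/-! ### Correctness of the programs that write down the polygons -/

section

variable {B : Problem}

/-- What `circlePoints src c` and its loop preserve and compute. -/
structure CircleInv (src c : ℕ) (s : State) (k : ℕ) (s' : State) : Prop where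
  int : ∀ r < 10, s'.int r = s.int r
  real : s'.real 1 = s.real 1
  arr : ∀ d, d ≠ c → d ≠ c + 1 → s'.arr d = s.arr d
  pos : s'.int 10 = k
  cos : ∀ j < k, s'.arr c j = Real.cos (s.arr src j / s.real 1) ∧
    s'.arr c (j + s.int src) = -Real.cos (s.arr src j / s.real 1)
  sin : ∀ j < k, s'.arr (c + 1) j = Real.sin (s.arr src j / s.real 1) ∧
    s'.arr (c + 1) (j + s.int src) = -Real.sin (s.arr src j / s.real 1)

/-- Step `k` writes a value at `k` and its negative at `k + N`; since `k < N`, neither hits a cell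
written earlier. Points and vertices are both stored this way. -/
theorem update_update_extend {f : ℕ → ℝ} {k N : ℕ} {u : ℕ → ℝ} (hk : k < N)
    (h : ∀ j < k, f j = u j ∧ f (j + N) = -u j) (j : ℕ) (hj : j < k + 1) :
    Function.update (Function.update f k (u k)) (k + N) (-u k) j = u j ∧
    Function.update (Function.update f k (u k)) (k + N) (-u k) (j + N) = -u j := by
  rcases Nat.lt_succ_iff_lt_or_eq.1 hj with hj | rfl
  · rw [Function.update_of_ne (by omega), Function.update_of_ne (by omega),
      Function.update_of_ne (by omega), Function.update_of_ne (by omega)]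
    exact h j hj
  · rw [Function.update_of_ne (by omega), Function.update_self, Function.update_self]
    exact ⟨rfl, rfl⟩

theorem runs_circleStep {src c : ℕ} (hsrc : src < 3) (hc : 3 < c) {s s' : State} {k : ℕ}
    (h : CircleInv src c s k s') (hk : k < s.int src) :
    Runs B (circleStep src c) s' (circleStep src c).cost (CircleInv src c s (k + 1)) := by
  have hint := h.int src (by omega)
  have harr := h.arr src (by omega) (by omega)
  refine Runs.of_wp ⟨fun r hr => ?_, h.real, fun d hd hd' => ?_, ?_, ?_, ?_⟩
  · simp only [State.setInt_int, State.setCell_int, State.setReal_int, show r ≠ 10 by omega,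
      if_false]
    exact h.int r hr
  · simp only [State.setInt_arr, State.setCell_arr, State.setReal_arr, hd, hd', if_false]
    exact h.arr d hd hd'
  · simp [State.setInt_int, State.setCell_int, State.setReal_int, IExp.eval, h.pos]
  · convert update_update_extend hk h.cos using 4 <;>
    simp [State.setInt_arr, State.setCell_arr, State.setReal_arr, State.setCell_int,
      State.setReal_int, State.setCell_real, State.setReal_real, IExp.eval, RExp.eval, h.pos,
      h.real, hint, harr]
  · convert update_update_extend hk h.sin using 4 <;>
    simp [State.setInt_arr, State.setCell_arr, State.setReal_arr, State.setCell_int,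
      State.setReal_int, State.setCell_real, State.setReal_real, IExp.eval, RExp.eval, h.pos,
      h.real, hint, harr]

theorem runs_circlePoints {src c : ℕ} (hsrc : src < 3) (hc : 3 < c) (s : State) :
    Runs B (circlePoints src c) s (60 * (s.int src + 1)) (CircleInv src c s (s.int src)) := by
  refine Runs.mono (Runs.seq (Q₁ := CircleInv src c s 0) (Runs.of_wp ?_) fun s' hs' =>
    Runs.loop (N := s.int src) (c := (circleStep src c).cost)
      (fun k s' => CircleInv src c s k s' ∧ k ≤ s.int src) (fun k s' hs' hb => ?_)
      ⟨hs', Nat.zero_le _⟩) ?_ ?_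
  · refine ⟨fun r hr => ?_, rfl, fun d _ _ => rfl, rfl, fun j hj => by omega, fun j hj => by omega⟩
    simp only [State.setInt_int]
    split_ifs <;> omega
  · have hk : k < s.int src := by
      have : s'.int 10 < s'.int src := hb
      rwa [hs'.1.pos, hs'.1.int src (by omega)] at this
    exact ⟨hk, (runs_circleStep hsrc hc hs'.1 hk).mono le_rfl fun _ h => ⟨h, hk⟩⟩
  · simp [circleStep, Prog.cost, BExp.cost, IExp.cost, RExp.cost]
    omega
  · rintro s' ⟨hb, k, h, hk⟩
    have hk' : ¬ k < s.int src := by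
      have : ¬ s'.int 10 < s'.int src := hb
      rwa [h.pos, h.int src (by omega)] at this
    obtain rfl : k = s.int src := by omega
    exact h

/-- The arrays written by `circlePoints` list the points with the periodized arguments. -/
theorem CircleInv.cos_periodize {src c : ℕ} {s s' : State}
    (h : CircleInv src c s (s.int src) s') {j : ℕ} (hj : j < 2 * s.int src) :
    s'.arr c j = Real.cos (periodize (s.int src) (fun i => s.arr src i / s.real 1) j) := by
  rcases Nat.lt_or_ge j (s.int src) with hj' | hj'
  · rw [periodize_of_lt _ hj', (h.cos j hj').1]
  · obtain ⟨i, rfl⟩ := Nat.exists_eq_add_of_le' hj'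
    rw [periodize_add (by omega), periodize_of_lt _ (by omega), (h.cos i (by omega)).2,
      Real.cos_add_pi]

theorem CircleInv.sin_periodize {src c : ℕ} {s s' : State}
    (h : CircleInv src c s (s.int src) s') {j : ℕ} (hj : j < 2 * s.int src) :
    s'.arr (c + 1) j = Real.sin (periodize (s.int src) (fun i => s.arr src i / s.real 1) j) := by
  rcases Nat.lt_or_ge j (s.int src) with hj' | hj'
  · rw [periodize_of_lt _ hj', (h.sin j hj').1]
  · obtain ⟨i, rfl⟩ := Nat.exists_eq_add_of_le' hj'
    rw [periodize_add (by omega), periodize_of_lt _ (by omega), (h.sin i (by omega)).2,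
      Real.sin_add_pi]

/-- The arrays `8` to `11` hold the end points of the arcs. -/
structure HoldsArcs (m : ℕ) (a b : ℕ → ℝ) (s : State) : Prop where
  int : s.int 1 = m
  left_cos : ∀ j < 2 * m, s.arr 8 j = Real.cos (a j)
  left_sin : ∀ j < 2 * m, s.arr 9 j = Real.sin (a j)
  right_cos : ∀ j < 2 * m, s.arr 10 j = Real.cos (b j)
  right_sin : ∀ j < 2 * m, s.arr 11 j = Real.sin (b j)

/-- What `vertices` and its loop preserve and compute. -/
structure VertexInv (m : ℕ) (a b : ℕ → ℝ) (s : State) (k : ℕ) (s' : State) : Prop where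
  int : ∀ r < 10, s'.int r = s.int r
  arr : ∀ d, d ≠ 6 → d ≠ 7 → s'.arr d = s.arr d
  pos : s'.int 10 = k
  re : ∀ j < k, s'.arr 6 j = (gapVertex a b j).re ∧ s'.arr 6 (j + m) = -(gapVertex a b j).re
  im : ∀ j < k, s'.arr 7 j = (gapVertex a b j).im ∧ s'.arr 7 (j + m) = -(gapVertex a b j).im

theorem gapVertex_re (a b : ℕ → ℝ) (i : ℕ) : (gapVertex a b i).re = Real.cos (a (i + 1)) +
    ((Real.cos (b (i + 1)) - Real.cos (a (i + 1))) * (Real.sin (a (i + 2)) - Real.sin (b (i + 1))) -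
        (Real.sin (b (i + 1)) - Real.sin (a (i + 1))) *
          (Real.cos (a (i + 2)) - Real.cos (b (i + 1)))) /
      ((Real.cos (a (i + 1)) - Real.cos (b i)) * (Real.sin (a (i + 2)) - Real.sin (b (i + 1))) -
        (Real.sin (a (i + 1)) - Real.sin (b i)) * (Real.cos (a (i + 2)) - Real.cos (b (i + 1)))) *
      (Real.cos (a (i + 1)) - Real.cos (b i)) := by
  rw [gapVertex, Complex.add_re, Complex.smul_re]
  rfl

theorem gapVertex_im (a b : ℕ → ℝ) (i : ℕ) : (gapVertex a b i).im = Real.sin (a (i + 1)) +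
    ((Real.cos (b (i + 1)) - Real.cos (a (i + 1))) * (Real.sin (a (i + 2)) - Real.sin (b (i + 1))) -
        (Real.sin (b (i + 1)) - Real.sin (a (i + 1))) *
          (Real.cos (a (i + 2)) - Real.cos (b (i + 1)))) /
      ((Real.cos (a (i + 1)) - Real.cos (b i)) * (Real.sin (a (i + 2)) - Real.sin (b (i + 1))) -
        (Real.sin (a (i + 1)) - Real.sin (b i)) * (Real.cos (a (i + 2)) - Real.cos (b (i + 1)))) *
      (Real.sin (a (i + 1)) - Real.sin (b i)) := by
  rw [gapVertex, Complex.add_im, Complex.smul_im]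
  rfl

/-- The step reads arc ends with index up to `k + 2`. These cells have been written, since `k < m`
and `2 ≤ m` give `k + 2 < 2 * m`. -/
theorem runs_vertexStep {m : ℕ} {a b : ℕ → ℝ} {s s' : State} (hs : HoldsArcs m a b s)
    (hm : 2 ≤ m) {k : ℕ} (h : VertexInv m a b s k s') (hk : k < m) :
    Runs B vertexStep s' vertexStep.cost (VertexInv m a b s (k + 1)) := by
  have hint := (h.int 1 (by omega)).trans hs.int
  have e8 := h.arr 8 (by omega) (by omega)
  have e9 := h.arr 9 (by omega) (by omega)
  have e10 := h.arr 10 (by omega) (by omega)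
  have e11 := h.arr 11 (by omega) (by omega)
  refine Runs.of_wp ⟨fun r hr => ?_, fun d hd hd' => ?_, ?_, ?_, ?_⟩
  · simp only [State.setInt_int, State.setCell_int, State.setReal_int, show r ≠ 10 by omega,
      show r ≠ 11 by omega, show r ≠ 12 by omega, if_false]
    exact h.int r hr
  · simp only [State.setInt_arr, State.setCell_arr, State.setReal_arr, hd, hd', if_false]
    exact h.arr d hd hd'
  · simp [State.setInt_int, State.setCell_int, State.setReal_int, IExp.eval, h.pos]
  · convert update_update_extend hk h.re using 4 <;>
    simp [State.setInt_arr, State.setCell_arr, State.setReal_arr, State.setCell_int,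
      State.setReal_int, State.setInt_int, State.setCell_real, State.setReal_real, IExp.eval,
      RExp.eval, h.pos, hint, e8, e9, e10, e11, diff,
      hs.left_cos (k + 1) (by omega), hs.left_cos (k + 2) (by omega),
      hs.left_sin (k + 1) (by omega), hs.left_sin (k + 2) (by omega), hs.right_cos k (by omega),
      hs.right_cos (k + 1) (by omega), hs.right_sin k (by omega),
      hs.right_sin (k + 1) (by omega), gapVertex_re]
  · convert update_update_extend hk h.im using 4 <;>
    simp [State.setInt_arr, State.setCell_arr, State.setReal_arr, State.setCell_int,
      State.setReal_int, State.setInt_int, State.setCell_real, State.setReal_real, IExp.eval,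
      RExp.eval, h.pos, hint, e8, e9, e10, e11, diff,
      hs.left_cos (k + 1) (by omega), hs.left_cos (k + 2) (by omega),
      hs.left_sin (k + 1) (by omega), hs.left_sin (k + 2) (by omega), hs.right_cos k (by omega),
      hs.right_cos (k + 1) (by omega), hs.right_sin k (by omega),
      hs.right_sin (k + 1) (by omega), gapVertex_im]

theorem runs_vertices {m : ℕ} {a b : ℕ → ℝ} {s : State} (hs : HoldsArcs m a b s)
    (hm : 2 ≤ m) : Runs B vertices s (200 * (m + 1)) (VertexInv m a b s m) := by
  refine Runs.mono (Runs.seq (Q₁ := VertexInv m a b s 0) (Runs.of_wp ?_) fun s' hs' =>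
    Runs.loop (N := m) (c := vertexStep.cost)
      (fun k s' => VertexInv m a b s k s' ∧ k ≤ m) (fun k s' hs' hb => ?_)
      ⟨hs', Nat.zero_le _⟩) ?_ ?_
  · refine ⟨fun r hr => ?_, fun d _ _ => rfl, rfl, fun j hj => by omega, fun j hj => by omega⟩
    simp only [State.setInt_int]
    split_ifs <;> omega
  · have hk : k < m := by
      have : s'.int 10 < s'.int 1 := hb
      rwa [hs'.1.pos, hs'.1.int 1 (by omega), hs.int] at this
    exact ⟨hk, (runs_vertexStep hs hm hs'.1 hk).mono le_rfl fun _ h => ⟨h, hk⟩⟩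
  · simp [vertexStep, diff, Prog.cost, BExp.cost, IExp.cost, RExp.cost]
    omega
  · rintro s' ⟨hb, k, h, hk⟩
    have hk' : ¬ k < m := by
      have : ¬ s'.int 10 < s'.int 1 := hb
      rwa [h.pos, h.int 1 (by omega), hs.int] at this
    obtain rfl : k = m := by omega
    exact h

/-- The arrays written by `vertices` list the vertices of the polygon. -/
theorem VertexInv.eq_gapVertex {m : ℕ} {a b : ℕ → ℝ} {s s' : State}
    (h : VertexInv m a b s m s') (g : GapSystem m a b) {j : ℕ} (hj : j < 2 * m) :
    s'.arr 6 j = (gapVertex a b j).re ∧ s'.arr 7 j = (gapVertex a b j).im := by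
  rcases Nat.lt_or_ge j m with hj' | hj'
  · exact ⟨(h.re j hj').1, (h.im j hj').1⟩
  · obtain ⟨i, rfl⟩ := Nat.exists_eq_add_of_le' hj'
    rw [g.gapVertex_add, (h.re i (by omega)).2, (h.im i (by omega)).2]
    exact ⟨rfl, rfl⟩

/-- The memory after sorting. -/
structure Prepared (n m : ℕ) (p a b : ℕ → ℝ) (s : State) : Prop where
  len : s.int 0 = n
  left_len : s.int 1 = m
  right_len : s.int 2 = m
  pts : s.arr 0 = p
  left : s.arr 1 = a
  right : s.arr 2 = b
  spread : s.real 0 = p (n - 1) - p 0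
  sorted : SortedSegs n m p a b

theorem runs_writePolygons {n m : ℕ} {p a b : ℕ → ℝ} {s : State} (hs : Prepared n m p a b s)
    (hn : 2 ≤ n) (hm : 2 ≤ m) :
    ∃ (h : AngleSystem n (periodize n fun i => p i / circleScale n m p a b))
      (g : GapSystem m (periodize m fun i => a i / circleScale n m p a b)
        (periodize m fun i => b i / circleScale n m p a b)),
      Runs B writePolygons s (500 * (n + m + 1)) fun s' =>
        [4, 5, 6, 7].map s'.contents = [h.polygon.verts.map Complex.re,
          h.polygon.verts.map Complex.im, g.polygon.verts.map Complex.re,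
          g.polygon.verts.map Complex.im] := by
  set K := circleScale n m p a b with hKdef
  have hK : 1 ≤ K := hs.sorted.one_le_circleScale (by omega) (by omega)
  have hK0 : 0 < K := by linarith
  have hsc := hs.sorted.scale hK0
  have hpi := Real.pi_gt_three
  -- After scaling, the two spreads add up to at most `1`, safely below `π`.
  have hsmall : p (n - 1) / K - p 0 / K + (b (m - 1) / K - a 0 / K) ≤ 1 := by
    rw [← sub_div, ← sub_div, ← add_div, div_le_one hK0, hKdef, circleScale]
    linarith
  have hp0 := hsc.le_pts (Nat.zero_le (n - 1)) (by omega)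
  have ha0 : a 0 / K ≤ b (m - 1) / K := (hsc.le 0 (by omega)).trans (hsc.right_le (by omega))
  have h := hsc.angleSystem hn (by linarith)
  have g := hsc.gapSystem hm (by linarith)
  refine ⟨h, g, ?_⟩
  refine Runs.mono (T := Prog.cost (.setR 1 (.add (.add (.reg 0)
    (.sub (.load 2 (.sub (.reg 1) (.const 1))) (.load 1 (.const 0)))) (.const 1))) +
    (60 * (n + 1) + (60 * (m + 1) + (60 * (m + 1) + (200 * (m + 1) + 16)))))
    (Runs.seq (Q₁ := fun s' => s'.int = s.int ∧ s'.arr = s.arr ∧ s'.real 1 = K)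
      (Runs.of_wp ?_) ?_) ?_ fun _ h => h
  · refine ⟨rfl, rfl, ?_⟩
    simp [State.setReal_real, RExp.eval, IExp.eval, hs.left_len, hs.left, hs.right, hs.spread,
      hKdef, circleScale]
  · rintro s₁ ⟨i₁, r₁, k₁⟩
    refine Runs.seq ((runs_circlePoints (src := 0) (c := 4) (by omega) (by omega) s₁).mono
      (by rw [i₁, hs.len]) fun _ h => h) fun s₂ h₂ => ?_
    have n1 : s₁.int 1 = m := by rw [i₁, hs.left_len]
    have n2 : s₂.int 1 = m := by rw [h₂.int 1 (by omega), n1]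
    refine Runs.seq ((runs_circlePoints (src := 1) (c := 8) (by omega) (by omega) s₂).mono
      (by rw [n2]) fun _ h => h) fun s₃ h₃ => ?_
    have n3 : s₃.int 2 = m := by
      rw [h₃.int 2 (by omega), h₂.int 2 (by omega), i₁, hs.right_len]
    refine Runs.seq ((runs_circlePoints (src := 2) (c := 10) (by omega) (by omega) s₃).mono
      (by rw [n3]) fun _ h => h) fun s₄ h₄ => ?_
    have k2 : s₂.real 1 = K := by rw [h₂.real, k₁]
    have k3 : s₃.real 1 = K := by rw [h₃.real, k2]
    have r2 : s₂.arr 1 = a := by rw [h₂.arr 1 (by omega) (by omega), r₁, hs.left]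
    have r3 : s₃.arr 2 = b := by
      rw [h₃.arr 2 (by omega) (by omega), h₂.arr 2 (by omega) (by omega), r₁, hs.right]
    have c3 := fun j hj => h₃.cos_periodize (j := j) hj
    have d3 := fun j hj => h₃.sin_periodize (j := j) hj
    have c4 := fun j hj => h₄.cos_periodize (j := j) hj
    have d4 := fun j hj => h₄.sin_periodize (j := j) hj
    rw [n2, k2, r2] at c3 d3
    rw [n3, k3, r3] at c4 d4
    have ha : HoldsArcs m (periodize m fun i => a i / K) (periodize m fun i => b i / K) s₄ := by
      refine ⟨by rw [h₄.int 1 (by omega), h₃.int 1 (by omega), n2], ?_, ?_, c4, d4⟩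
      · rw [h₄.arr 8 (by omega) (by omega)]; exact c3
      · rw [h₄.arr 9 (by omega) (by omega)]; exact d3
    refine Runs.seq (runs_vertices ha hm) fun s₅ h₅ => Runs.of_wp ?_
    have n5 : s₅.int 0 = n := by
      rw [h₅.int 0 (by omega), h₄.int 0 (by omega), h₃.int 0 (by omega), h₂.int 0 (by omega), i₁,
        hs.len]
    have m5 : s₅.int 1 = m := by
      rw [h₅.int 1 (by omega), h₄.int 1 (by omega), h₃.int 1 (by omega), h₂.int 1 (by omega), i₁,
        hs.left_len]
    have c2 := fun j hj => h₂.cos_periodize (j := j) hj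
    have d2 := fun j hj => h₂.sin_periodize (j := j) hj
    rw [i₁, hs.len, k₁, r₁, hs.pts] at c2 d2
    have r4 : s₅.arr 4 = s₂.arr 4 := by
      rw [h₅.arr 4 (by omega) (by omega), h₄.arr 4 (by omega) (by omega),
        h₃.arr 4 (by omega) (by omega)]
    have r5 : s₅.arr 5 = s₂.arr 5 := by
      rw [h₅.arr 5 (by omega) (by omega), h₄.arr 5 (by omega) (by omega),
        h₃.arr 5 (by omega) (by omega)]
    simp only [Prog.wp, List.map_cons, List.map_nil, State.contents, State.setInt_int,
      State.setInt_arr, IExp.eval, n5, m5, r4, r5, AngleSystem.polygon, GapSystem.polygon,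
      List.map_map, ← two_mul, Nat.reduceEqDiff, if_false, if_true,
      OfNat.zero_ne_ofNat, OfNat.one_ne_ofNat, List.cons.injEq, and_true]
    refine ⟨List.map_congr_left fun j hj => ?_, List.map_congr_left fun j hj => ?_,
      List.map_congr_left fun j hj => ?_, List.map_congr_left fun j hj => ?_⟩
    · exact c2 j (List.mem_range.1 hj)
    · exact d2 j (List.mem_range.1 hj)
    · exact (h₅.eq_gapVertex g (List.mem_range.1 hj)).1
    · exact (h₅.eq_gapVertex g (List.mem_range.1 hj)).2
  · simp only [Prog.cost, RExp.cost, IExp.cost]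
    omega

end

end RealRAM

/-! ### Correctness and running time of the reduction -/

namespace RealRAM

section

variable {B : Problem}

/-- The time bound for an input of `n` points and at most `c * n` intervals. -/
def timeBound (c n : ℕ) : ℕ :=
  2000 * ((c + 1) * n + 1) * (Nat.clog 2 ((c + 1) * n) + 1)

/-- A common bound `M` for both lengths gives the three sorts the same time bound. -/
theorem runs_sortData {c : ℕ} (I : SegContPntInst c) {M : ℕ} (hn : I.pts.length ≤ M)
    (hm : I.segs.length ≤ M) :
    Runs B sortData (State.init ((SegContPnt c).enc I))
      (600 * (M + 1) * (Nat.clog 2 M + 1) + 8) fun s' =>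
        ∃ p a b, Prepared I.pts.length I.segs.length p a b s' ∧
          ((SegContPnt c).yes I ↔ ContainsTranslate I.pts.length I.segs.length p a b) := by
  set s := State.init ((SegContPnt c).enc I) with hs
  have n0 : s.int 0 = I.pts.length := rfl
  have n1 : s.int 1 = I.segs.length := List.length_map ..
  have n2 : s.int 2 = I.segs.length := List.length_map ..
  have v0 : values (s.arr 0) I.pts.length = (I.pts : Multiset ℝ) := values_getD _
  have v1 : values (s.arr 1) I.segs.length = (I.segs.map Prod.fst : List ℝ) := by
    rw [← values_getD, List.length_map]; rfl
  have v2 : values (s.arr 2) I.segs.length = (I.segs.map Prod.snd : List ℝ) := by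
    rw [← values_getD, List.length_map]; rfl
  have time : ∀ k ≤ M, 200 * (k + 1) * (Nat.clog 2 k + 1) ≤
      200 * (M + 1) * (Nat.clog 2 M + 1) := fun k hk =>
    Nat.mul_le_mul (by omega) (Nat.succ_le_succ (Nat.clog_mono_right 2 hk))
  refine Runs.mono (T := 200 * (M + 1) * (Nat.clog 2 M + 1) +
    (200 * (M + 1) * (Nat.clog 2 M + 1) + (200 * (M + 1) * (Nat.clog 2 M + 1) + 8)))
    (Runs.seq ((runs_mergeSort (by omega) s).mono (by rw [n0]; exact time _ hn) fun _ h => h)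
    fun s₁ ⟨f₁, o₁, w₁⟩ => ?_) (by linarith) fun _ h => h
  have n1' : s₁.int 1 = I.segs.length := by rw [f₁.int 1 (by omega), n1]
  refine Runs.seq ((runs_mergeSort (by omega) s₁).mono (by rw [n1']; exact time _ hm) fun _ h => h)
    fun s₂ ⟨f₂, o₂, w₂⟩ => ?_
  have n2' : s₂.int 2 = I.segs.length := by rw [f₂.int 2 (by omega), f₁.int 2 (by omega), n2]
  refine Runs.seq ((runs_mergeSort (by omega) s₂).mono (by rw [n2']; exact time _ hm) fun _ h => h)
    fun s₃ ⟨f₃, o₃, w₃⟩ => Runs.of_wp ?_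
  have m0 : s₃.int 0 = I.pts.length := by
    rw [f₃.int 0 (by omega), f₂.int 0 (by omega), f₁.int 0 (by omega), n0]
  have m1 : s₃.int 1 = I.segs.length := by
    rw [f₃.int 1 (by omega), f₂.int 1 (by omega), n1']
  have m2 : s₃.int 2 = I.segs.length := by rw [f₃.int 2 (by omega), n2']
  have a0 : s₃.arr 0 = s₁.arr 0 := by
    rw [f₃.arr 0 (by omega) (by omega), f₂.arr 0 (by omega) (by omega)]
  have a1 : s₃.arr 1 = s₂.arr 1 := f₃.arr 1 (by omega) (by omega)
  rw [n0, ← a0] at o₁ w₁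
  rw [n1', ← a1, f₁.arr 1 (by omega) (by omega)] at w₂
  rw [n1', ← a1] at o₂
  rw [n2', f₂.arr 2 (by omega) (by omega), f₁.arr 2 (by omega) (by omega)] at w₃
  rw [n2'] at o₃
  obtain ⟨hsorted, hyes⟩ := I.sorted o₁ o₂ o₃ (w₁.trans v0) (w₂.trans v1) (w₃.trans v2)
  refine ⟨s₃.arr 0, s₃.arr 1, s₃.arr 2, ⟨m0, m1, m2, rfl, rfl, rfl, ?_, hsorted⟩, hyes⟩
  simp [State.setReal_real, RExp.eval, IExp.eval, m0]

/-- A problem that can tell whether the polygon of an angle system can be turned into the polygon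
of a gap system. -/
def DecidesTurning (c : ℕ) (B : Problem) : Prop :=
  ∀ (n m : ℕ) (p a b : ℕ → ℝ) (h : AngleSystem n p) (g : GapSystem m a b), m ≤ c * n →
    ∃ J : B.Inst, B.enc J = [h.polygon.verts.map Complex.re, h.polygon.verts.map Complex.im,
        g.polygon.verts.map Complex.re, g.polygon.verts.map Complex.im] ∧
      B.size J = 2 * n ∧
      (B.yes J ↔ ∃ v : ℝ, ∀ j < n, ∃ i < m, ∃ k : ℤ, p j + v + k * Real.pi ∈ Set.Icc (a i) (b i))

theorem exec_reduction {c : ℕ} (hB : DecidesTurning c B) (I : SegContPntInst c) :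
    ∃ (s : State) (t : ℕ) (qs : List ℕ),
      Exec B reduction (State.init ((SegContPnt c).enc I)) s t qs ∧
      t ≤ timeBound c I.pts.length ∧ qs.length ≤ 1 ∧ (∀ q ∈ qs, q ≤ 2 * I.pts.length) ∧
      (s.int 0 = 1 ↔ (SegContPnt c).yes I) := by
  have hlen := I.length_le
  set s := State.init ((SegContPnt c).enc I) with hs
  set n := I.pts.length with hn
  set m := I.segs.length with hm
  set M := (c + 1) * n with hM
  have hnM : n ≤ M := Nat.le_mul_of_pos_left n (Nat.succ_pos c)
  have hmM : m ≤ M := hlen.trans (Nat.mul_le_mul_right n (Nat.le_succ c))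
  have hT : timeBound c n = 2000 * (M + 1) * (Nat.clog 2 M + 1) := rfl
  -- The part linear in `M` pays for everything after sorting.
  have hT1 : 600 * (M + 1) * (Nat.clog 2 M + 1) + 1400 * (M + 1) ≤ timeBound c n := by
    rw [hT]; nlinarith [Nat.zero_le (Nat.clog 2 M * M), Nat.zero_le (Nat.clog 2 M)]
  have n0 : s.int 0 = n := rfl
  have n1 : s.int 1 = m := List.length_map ..
  have c1 : (BExp.ilt (.reg 0) (.const 1)).cost = 3 := rfl
  have c2 : (BExp.ilt (.reg 1) (.const 1)).cost = 3 := rfl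
  by_cases hn0 : n = 0
  · refine ⟨_, _, _, .ite_true ?_ (.setI _ _ _), ?_, by simp, by simp, ?_⟩
    · change s.int 0 < 1
      omega
    · simp only [c1, IExp.cost]; omega
    · have : I.pts = [] := List.length_eq_zero_iff.1 hn0
      simp [State.setInt_int, IExp.eval, SegContPnt, this]
  by_cases hm0 : m = 0
  · refine ⟨_, _, _, .ite_false ?_ (.ite_true ?_ (.setI _ _ _)), ?_, by simp, by simp, ?_⟩
    · change ¬ s.int 0 < 1
      omega
    · change s.int 1 < 1
      omega
    · simp only [c1, c2, IExp.cost]; omega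
    · have h1 : I.segs = [] := List.length_eq_zero_iff.1 hm0
      have h2 : I.pts ≠ [] := fun h => hn0 (List.length_eq_zero_iff.2 h)
      obtain ⟨x, hx⟩ := List.exists_mem_of_ne_nil _ h2
      simp only [State.setInt_int, IExp.eval, SegContPnt, h1, if_true, zero_ne_one, false_iff]
      rintro ⟨v, hv⟩
      simpa using hv ⟨x, hx, rfl⟩
  obtain ⟨s₁, t₁, he₁, ht₁, p, a, b, hp, hyes⟩ := runs_sortData (B := B) I hnM hmM
  have outer : ∀ {s' t qs}, Exec B (.ite (.and (.ilt (.const 1) (.reg 0)) (.ilt (.const 1) (.reg 1)))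
      (.seq writePolygons (.ask [4, 5, 6, 7] 0)) decideSmall) s₁ s' t qs →
      Exec B reduction s s' (3 + (3 + (t₁ + t) + 1) + 1) qs := fun h =>
    .ite_false (show ¬ s.int 0 < 1 by omega) (.ite_false (show ¬ s.int 1 < 1 by omega)
      (he₁.seq h))
  by_cases hsmall : n < 2 ∨ m < 2
  · have hct : ContainsTranslate n m p a b ↔ p (n - 1) - p 0 ≤ b 0 - a 0 :=
      hp.sorted.containsTranslate_of_small (by omega) (by omega) hsmall
    have hb : ¬ (1 < s₁.int 0 ∧ 1 < s₁.int 1) := by rw [hp.len, hp.left_len]; omega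
    obtain ⟨s', t, he, ht, hq⟩ : Runs B decideSmall s₁ decideSmall.cost fun s' =>
        (s'.int 0 = 1 ↔ ContainsTranslate n m p a b) := by
      refine Runs.of_wp ⟨fun h => ?_, fun h => ?_⟩
      · have : b 0 - a 0 < p (n - 1) - p 0 := by
          simpa only [BExp.holds, RExp.eval, IExp.eval, hp.right, hp.left, hp.spread] using h
        simpa [Prog.wp, State.setInt_int, IExp.eval, hct, lt_sub_iff_add_lt] using this
      · have : p (n - 1) - p 0 ≤ b 0 - a 0 := by
          simpa only [BExp.holds, RExp.eval, IExp.eval, hp.right, hp.left, hp.spread, not_lt] using h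
        simpa [Prog.wp, State.setInt_int, IExp.eval, hct] using this
    refine ⟨s', _, [], outer (.ite_false hb he), ?_, by simp, by simp, hq.trans hyes.symm⟩
    simp only [decideSmall, Prog.cost, BExp.cost, RExp.cost, IExp.cost] at ht ⊢
    omega
  · push Not at hsmall
    obtain ⟨h, g, s', t, he, ht, hcont⟩ := runs_writePolygons (B := B) hp hsmall.1 hsmall.2
    obtain ⟨J, hJ, hsize, hJyes⟩ := hB n m _ _ _ h g hlen
    have hK := hp.sorted.one_le_circleScale (by omega) (by omega)
    have hK0 : 0 < circleScale n m p a b := by linarith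
    have hlt : p (n - 1) / circleScale n m p a b - p 0 / circleScale n m p a b +
        (b (m - 1) / circleScale n m p a b - a 0 / circleScale n m p a b) < Real.pi := by
      rw [← sub_div, ← sub_div, ← add_div, div_lt_iff₀ hK0]
      have := Real.pi_gt_three
      have e : p (n - 1) - p 0 + (b (m - 1) - a 0) = circleScale n m p a b - 1 := by
        rw [circleScale]; ring
      rw [e]
      nlinarith
    -- The oracle's answer is carried back from shifts modulo `π` to translations of the scaled
    -- data, then to the unscaled data and the instance.
    rw [(hp.sorted.scale hK0).exists_translate_mod_pi_iff hlt,
      SortedSegs.containsTranslate_scale hK0, ← hyes] at hJyes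
    have hb : 1 < s₁.int 0 ∧ 1 < s₁.int 1 := by rw [hp.len, hp.left_len]; omega
    have ht' : 3 + (3 + (t₁ + (7 + (t + 1) + 1)) + 1) + 1 ≤ timeBound c n := by omega
    have hqs : ∀ q ∈ [] ++ [B.size J], q ≤ 2 * n := by simp [hsize]
    by_cases hJy : B.yes J
    · exact ⟨_, _, _, outer (.ite_true hb (he.seq (.ask_yes (hcont.trans hJ.symm) hJy))), ht',
        by simp, hqs, by simp [State.setInt_int, hJyes.1 hJy]⟩
    · exact ⟨_, _, _, outer (.ite_true hb (he.seq (.ask_no (hcont.trans hJ.symm) hJy))), ht',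
        by simp, hqs, by simpa [State.setInt_int] using fun h => hJy (hJyes.2 h)⟩

theorem isBigO_timeBound (c : ℕ) : (fun n => (timeBound c n : ℝ)) =O[Filter.atTop]
    fun n : ℕ => (n : ℝ) * Real.log n := by
  -- The factor `c + 2` comes from `(c + 1) * n + 1 ≤ (c + 2) * n`, the bracket from the bound for
  -- the rounded logarithm, whose constant terms are absorbed by `1 ≤ log n` for `3 ≤ n`.
  refine Asymptotics.IsBigO.of_bound (2000 * (c + 2) * (Real.log (c + 1) / Real.log 2 +
    1 / Real.log 2 + 2)) ?_
  filter_upwards [Filter.eventually_ge_atTop 3] with n hn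
  have hn' : (3 : ℝ) ≤ n := by exact_mod_cast hn
  have hn0 : (0 : ℝ) < n := by linarith
  have hL : 1 ≤ Real.log n := by
    rw [Real.le_log_iff_exp_le hn0]
    exact (Real.exp_one_lt_d9.le.trans (by norm_num)).trans hn'
  have h2 : 0 < Real.log 2 := Real.log_pos (by norm_num)
  have hc : 0 ≤ Real.log (c + 1) := Real.log_nonneg (by linarith [Nat.cast_nonneg (α := ℝ) c])
  have hclog : (Nat.clog 2 ((c + 1) * n) : ℝ) ≤
      Real.log (c + 1) / Real.log 2 + Real.log n / Real.log 2 + 1 := by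
    rw [← Real.natCeil_logb_natCast]
    refine (Nat.ceil_lt_add_one (Real.logb_nonneg (by norm_num) ?_)).le.trans_eq ?_
    · exact_mod_cast Nat.mul_pos (Nat.succ_pos c) (by omega : 0 < n)
    · rw [Real.logb]
      push_cast
      rw [Real.log_mul (by positivity) hn0.ne', add_div]
  have h3 : (Nat.clog 2 ((c + 1) * n) : ℝ) + 1 ≤
      (Real.log (c + 1) / Real.log 2 + 1 / Real.log 2 + 2) * Real.log n := by
    have : Real.log (c + 1) / Real.log 2 ≤ Real.log (c + 1) / Real.log 2 * Real.log n :=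
      le_mul_of_one_le_right (div_nonneg hc h2.le) hL
    have e : 1 / Real.log 2 * Real.log n = Real.log n / Real.log 2 := by ring
    refine (add_le_add_left hclog 1).trans ?_
    rw [add_mul, add_mul, e]
    linarith
  have h4 : ((c : ℝ) + 1) * n + 1 ≤ (c + 2) * n := by linarith
  rw [Real.norm_of_nonneg (Nat.cast_nonneg _), Real.norm_of_nonneg (by positivity), timeBound]
  push_cast
  calc 2000 * (((c : ℝ) + 1) * n + 1) * (Nat.clog 2 ((c + 1) * n) + 1)
      ≤ 2000 * ((c + 2) * n) *
        ((Real.log (c + 1) / Real.log 2 + 1 / Real.log 2 + 2) * Real.log n) := by gcongr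
    _ = _ := by ring

end

end RealRAM

open RealRAM in
theorem solvableUsing_of_decidesTurning {c : ℕ} {B : Problem} (hB : DecidesTurning c B) :
    SolvableUsing (SegContPnt c) B (fun n => (n : ℝ) * Real.log n) := by
  refine ⟨reduction, 1, fun n => 2 * n, timeBound c, ?_, isBigO_timeBound c,
    fun I => exec_reduction hB I⟩
  refine Asymptotics.IsBigO.of_bound 2 (Filter.Eventually.of_forall fun n => ?_)
  simp

theorem edges_polygon_le {c n m : ℕ} {p a b : ℕ → ℝ} (h : AngleSystem n p) (g : GapSystem m a b)
    (hmn : m ≤ c * n) : g.polygon.edges ≤ c * h.polygon.edges := by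
  simp only [ConvPoly.edges, AngleSystem.polygon, GapSystem.polygon, List.length_map,
    List.length_range]
  linarith

theorem edges_polygon {n : ℕ} {p : ℕ → ℝ} (h : AngleSystem n p) : h.polygon.edges = 2 * n := by
  simp [ConvPoly.edges, AngleSystem.polygon]

theorem mainTheorem3 :
    (∀ c : ℕ, ∃ c' : ℕ,
      SolvableUsing (SegContPnt c) (ConvPolyContRot c') (fun n => (n : ℝ) * Real.log n)) ∧
    (∀ c : ℕ, ∃ c' : ℕ,
      SolvableUsing (SegContPnt c) (ConvPolyContRigidMot c') (fun n => (n : ℝ) * Real.log n)) := by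
  constructor
  -- Antipodes double both edge numbers, so the same constant `c` works.
  · exact fun c => ⟨c, solvableUsing_of_decidesTurning fun n m p a b h g hmn =>
      ⟨⟨h.polygon, g.polygon, edges_polygon_le h g hmn⟩, rfl, edges_polygon h,
        h.exists_rotation_iff g⟩⟩
  · exact fun c => ⟨c, solvableUsing_of_decidesTurning fun n m p a b h g hmn =>
      ⟨⟨h.polygon, g.polygon, edges_polygon_le h g hmn⟩, rfl, edges_polygon h,
        h.exists_rigidMotion_iff g⟩⟩
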